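/- **Setting.** Let $G=(S,E)$ be a finite directed graph with edge costs $\mathbf{cost}=(cost_1,cost_2):E\to\mathbb R_{\ge0}^2$, let $start,goal\in S$ and $W\ge 0$. The cost of a path (a sequence of states in which consecutive states are joined by edges) is the sum of its edge costs. A start-goal path is *feasible* if its $cost_2$ is at most $W$, and *cost-optimal* if it is feasible and its pair $(cost_1,cost_2)$ is lexicographically smallest among all feasible start-goal paths. The forward direction $f$ goes from $start$ to $goal$ in $G$; the backward direction $b$ goes from $goal$ to $start$ in the reversed graph. For a direction $d$, $d'$ is the opposite one. The forward search has primary and secondary attributes $(p,s)=(1,2)$, the backward search $(p,s)=(2,1)$. **Initialisation of WC-BA\*.** Set $\overline f_2=W$ and $\overline f_1=\infty$ (shared). A *bounded A\** on $cost_p$ in direction $d$ with heuristic $e$ keeps for each reached state the lexicographically smallest $(g_p,g_s)$ found, where $s$ is the other attribute; it repeatedly expands an unexpanded reached state with smallest $(g_p+e,g_s)$, and stops when none is left or when $g_p+e>\overline f_p$ for that state. * *Round one*, two searches in parallel: a backward one on $cost_2$, giving $(h^f_2,ub^f_1)=(g_2,g_1)$ at expanded states and setting $\overline f_1\leftarrow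 g_1$ when $start$ is expanded; and a forward one on $cost_1$, giving $(h^b_1,ub^b_2)=(g_1,g_2)$. They use given heuristics (e.g. $0$) that are admissible and consistent for their targets. * *Round two*, when both are complete, two searches in parallel, restricted to the states expanded by both searches of round one: a forward one on $cost_2$ with heuristic $h^f_2$, giving $(h^b_2,ub^b_1)=(g_2,g_1)$; and a backward one on $cost_1$ with heuristic $h^b_1$, giving $(h^f_1,ub^f_2)=(g_1,g_2)$. Whenever one of them expands a state, its path is joined with the path found for this state by the round-one search on the same attribute, and if the joined path has $cost_2\le W$, then $\overline f_1$ is lowered to its $cost_1$ if that is smaller. All these values are $\infty$ at states that the respective search does not expand. **Constrained search.** Set $Sol=(\varnothing,\varnothing)$, $f^{sol}_2=\infty$. Each direction $d$ has $g^d_{min}\equiv\infty$ and a queue $Open^d$ containing one node at its initial state with $\mathbf g=(0,0)$. Each node $x$ stores its state $s(x)$, its parent, $\mathbf g(x)$, and $\mathbf f(x)=\mathbf g(x)+\mathbf h^d(s(x))$ as computed when it is generated. The two searches run in parallel with shared $\mathbf h,\mathbf{ub},\overline{\mathbf f},f_2^{sol},Sol$; their iterations are atomic and interleaved in an arbitrary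 way. One iteration in direction $d$, with $u=s(x)$: 1. If $Open^d=\emptyset$, this search is complete. Otherwise remove from $Open^d$ a node $x$ with lexicographically smallest $(f_p,f_s)$ (ties arbitrary). If $f_p(x)>\overline f_p$, this search is complete. 2. If $d=b$ and $f_1(x)>\overline f_1$, or if $g_s(x)\ge g^d_{min}(u)$, the iteration ends. 3. (HTF) If $g^d_{min}(u)=\infty$, set $h^{d'}_p(u)\leftarrow g_p(x)$ and $ub^{d'}_s(u)\leftarrow g_s(x)$. Then set $g^d_{min}(u)\leftarrow g_s(x)$. 4. (Early solution update) With the current values put $\mathbf a=\mathbf g(x)+\mathbf h^d(u)$ and $\mathbf c=\mathbf g(x)+\mathbf{ub}^d(u)$. * $d=f$: if $c_2\le W$, then if $a_1<\overline f_1$ or $c_2<f^{sol}_2$ set $(\overline f_1,f_2^{sol},Sol)\leftarrow(a_1,c_2,(x,\varnothing))$; otherwise (if $c_2>W$), if $a_2\le W$ and $c_1<\overline f_1$ set $(\overline f_1,f_2^{sol})\leftarrow(c_1,\infty)$. * $d=b$: if $c_1\le\overline f_1$, then if $c_1<\overline f_1$ or $a_2<f^{sol}_2$ set $(\overline f_1,f_2^{sol},Sol)\leftarrow(c_1,a_2,(\varnothing,x))$;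 otherwise (if $c_1>\overline f_1$), if $c_2\le W$ and $a_1<\overline f_1$ set $(\overline f_1,f_2^{sol})\leftarrow(a_1,\infty)$. 5. If $h^d_p(u)=ub^d_p(u)$, the iteration ends. Otherwise, for every successor $v$ of $u$ in direction $d$, generate the node $y$ with state $v$, parent $x$ and $\mathbf g(y)=\mathbf g(x)+\mathbf{cost}$ of the edge, and add it to $Open^d$ if $g_s(y)<g^d_{min}(v)$, $\mathbf g(y)\preceq\mathbf{ub}^{d'}(v)$ and $\mathbf f(y)\preceq\overline{\mathbf f}$ (componentwise). As soon as one of the two searches is complete, WC-BA\* stops and returns $Sol$. The path corresponding to a solution node $x$ of direction $d$ is the path given by its chain of parents joined with the path from $s(x)$ to the target of $d$ that round two found on the primary attribute of $d$ (the path behind the initial $h^d_p$). **Theorem.** For every instance, under every interleaving of the parallel searches and every choice among ties, WC-BA\* terminates. If a feasible start-goal path exists, the returned $Sol$ contains exactly one node, and the path corresponding to it is a cost-optimal start-goal path. If no feasible path exists, $Sol=(\varnothing,\varnothing)$ is returned. -/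

import Mathlib

open scoped NNReal ENNReal

noncomputable section

namespace WCSPP

/-- The two search directions. -/
inductive Dir
  | fwd
  | bwd
  deriving DecidableEq

/-- The opposite direction. -/
def Dir.opp : Dir → Dir
  | .fwd => .bwd
  | .bwd => .fwd

/-- The primary attribute of the constrained search in a direction. Attribute `0` is `cost₁`,
attribute `1` is `cost₂`; the forward search is in the `(f₁, f₂)` order, the backward search in
the `(f₂, f₁)` order. -/
def Dir.pri : Dir → Fin 2
  | .fwd => 0
  | .bwd => 1

/-- The secondary attribute of the constrained search in a direction. -/
def Dir.sec : Dir → Fin 2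
  | .fwd => 1
  | .bwd => 0

/-- The attribute other than `i`. -/
def other (i : Fin 2) : Fin 2 := if i = 0 then 1 else 0

/-- A problem instance: a directed graph whose edges carry two non-negative attributes
(`cost` is only relevant on edges), a start state, a goal state and the weight limit. -/
structure Instance (S : Type*) where
  edge : S → S → Prop
  cost : S → S → Fin 2 → ℝ≥0
  start : S
  goal : S
  W : ℝ≥0

section Paths

variable {S : Type*} (P : Instance S)

/-- The edges of the graph (forward) or of the reversed graph (backward). -/
def Instance.arc : Dir → S → S → Prop
  | .fwd => fun u v => P.edge u v
  | .bwd => fun u v => P.edge v u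

/-- The costs of the edges of the graph (forward) or of the reversed graph (backward). -/
def Instance.arcCost : Dir → S → S → Fin 2 → ℝ≥0
  | .fwd => fun u v => P.cost u v
  | .bwd => fun u v => P.cost v u

/-- The initial state of a search direction. -/
def Instance.initial : Dir → S
  | .fwd => P.start
  | .bwd => P.goal

/-- The target state of a search direction. -/
def Instance.target (d : Dir) : S := P.initial d.opp

/-- The sequence of states `π` is a path from `u` to `v` in direction `d`. -/
def Instance.IsPath (d : Dir) (u v : S) (π : List S) : Prop :=
  π.head? = some u ∧ π.getLast? = some v ∧ π.IsChain (P.arc d)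

/-- The cost of a sequence of states: the sum of the costs of its edges. -/
def Instance.pathCost (d : Dir) : List S → Fin 2 → ℝ≥0
  | [] => 0
  | [_] => 0
  | u :: v :: π => P.arcCost d u v + Instance.pathCost d (v :: π)

/-- `π` is a start-goal path within the weight limit. -/
def Instance.IsFeasible (π : List S) : Prop :=
  P.IsPath .fwd P.start P.goal π ∧ P.pathCost .fwd π 1 ≤ P.W

/-- `π` is a cost-optimal start-goal solution path: it has the lexicographically smallest
`(cost₁, cost₂)` among all start-goal paths within the weight limit. -/
def Instance.IsCostOptimal (π : List S) : Prop :=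
  P.IsFeasible π ∧ ∀ π', P.IsFeasible π' →
    toLex (P.pathCost .fwd π 0, P.pathCost .fwd π 1) ≤
      toLex (P.pathCost .fwd π' 0, P.pathCost .fwd π' 1)

/-- `e` is an admissible and consistent heuristic on attribute `i` for searching in direction `d`,
that is, it bounds the remaining cost to the target of that direction. -/
structure Instance.IsHeuristic (d : Dir) (i : Fin 2) (e : S → ℝ≥0) : Prop where
  admissible : ∀ u π, P.IsPath d u (P.target d) π → e u ≤ P.pathCost d π i
  consistent : ∀ u v, P.arc d u v → e u ≤ P.arcCost d u v i + e v

end Paths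

/-! ### Bounded single-objective A* (the initialisation phase) -/

/-- A label of a state in a preliminary search: the cost of a path from the root of the search to
the state, and the states on it, listed from the state back to the root. -/
structure Label (S : Type*) where
  cost : Fin 2 → ℝ≥0
  path : List S

/-- A preliminary search: the best label found so far for each state, the expanded states, and
whether the search has terminated. -/
structure HSearch (S : Type*) where
  label : S → Option (Label S)
  closed : Set S
  finished : Prop

namespace HSearch

variable {S : Type*}

open scoped Classical in
/-- A search restricted to `allowed` starts with the root as its only labelled state. -/
def init (root : S) (allowed : Set S) : HSearch S where
  label u := if u = root ∧ u ∈ allowed then some ⟨0, [u]⟩ else none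
  closed := ∅
  finished := False

/-- `u` waits for expansion with label `l`. -/
def IsOpen (s : HSearch S) (u : S) (l : Label S) : Prop := s.label u = some l ∧ u ∉ s.closed

/-- The queue key: the estimate on attribute `p` under the heuristic `e`, ties being broken by the
cost on the other attribute. -/
def key (p : Fin 2) (e : S → ℝ≥0∞) (u : S) (l : Label S) : ℝ≥0∞ ×ₗ ℝ≥0∞ :=
  toLex ((l.cost p : ℝ≥0∞) + e u, (l.cost (other p) : ℝ≥0∞))

/-- `u`, with label `l`, has a smallest key among the states waiting for expansion. -/
def IsLeast (p : Fin 2) (e : S → ℝ≥0∞) (s : HSearch S) (u : S) (l : Label S) : Prop :=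
  s.IsOpen u l ∧ ∀ u' l', s.IsOpen u' l' → key p e u l ≤ key p e u' l'

/-- The running search may expand `u`: it is least and its estimate is within the bound. -/
def CanExpand (p : Fin 2) (e : S → ℝ≥0∞) (bound : ℝ≥0∞) (s : HSearch S) (u : S)
    (l : Label S) : Prop :=
  ¬ s.finished ∧ s.IsLeast p e u l ∧ (l.cost p : ℝ≥0∞) + e u ≤ bound

/-- The running search terminates: nothing is left, or the least state is out of bounds. -/
def CanFinish (p : Fin 2) (e : S → ℝ≥0∞) (bound : ℝ≥0∞) (s : HSearch S) : Prop :=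
  ¬ s.finished ∧ ((∀ u l, ¬ s.IsOpen u l) ∨
    ∃ u l, s.IsLeast p e u l ∧ bound < (l.cost p : ℝ≥0∞) + e u)

open scoped Classical in
/-- Expand `u` (with label `l`) in direction `d`: close it and relabel the allowed unexpanded
successors which are reached by a path lexicographically smaller in the `(p, other p)` order. -/
def expand (P : Instance S) (d : Dir) (p : Fin 2) (allowed : Set S) (s : HSearch S) (u : S)
    (l : Label S) : HSearch S where
  label v :=
    let new : Label S := ⟨l.cost + P.arcCost d u v, v :: l.path⟩
    if P.arc d u v ∧ v ∈ allowed ∧ v ∉ insert u s.closed ∧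
        ∀ old, s.label v = some old →
          toLex (new.cost p, new.cost (other p)) < toLex (old.cost p, old.cost (other p))
    then some new else s.label v
  closed := insert u s.closed
  finished := s.finished

/-- Mark the search as terminated. -/
def finish (s : HSearch S) : HSearch S := { s with finished := True }

open scoped Classical in
/-- The cost on attribute `i` of the path found to an expanded state, `∞` at unexpanded states. -/
def value (s : HSearch S) (i : Fin 2) (u : S) : ℝ≥0∞ :=
  if u ∈ s.closed then (s.label u).elim ⊤ (fun l => (l.cost i : ℝ≥0∞)) else ⊤

/-- The path found, listed from the state to the root of the search. -/
def route (s : HSearch S) (u : S) : List S := (s.label u).elim [] Label.path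

end HSearch

/-- Round one of the initialisation: a backward search on `cost₂`, a forward search on `cost₁`,
and the shared upper bound on `cost₁`. -/
structure Round1 (S : Type*) where
  back2 : HSearch S
  fwd1 : HSearch S
  fbar1 : ℝ≥0∞

/-- Round two: a forward search on `cost₂` and a backward search on `cost₁`, with the results of
round one (`r.fbar1` is still the shared upper bound on `cost₁`). -/
structure Round2 (S : Type*) where
  r : Round1 S
  fwd2 : HSearch S
  back1 : HSearch S

namespace Round2

variable {S : Type*}

/-- Round two ignores the states which were not expanded by both searches of round one. -/
def allowed (r : Round1 S) : Set S := r.back2.closed ∩ r.fwd1.closed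

open scoped Classical in
/-- Path matching: join the path labelled `l` at `u` with the path found for `u` by the search `s`
of round one; if the joined path is within the weight limit, it may decrease the bound. -/
def matching (P : Instance S) (s : HSearch S) (u : S) (l : Label S) (fbar1 : ℝ≥0∞) : ℝ≥0∞ :=
  if (l.cost 1 : ℝ≥0∞) + s.value 1 u ≤ (P.W : ℝ≥0∞) then
    min fbar1 ((l.cost 0 : ℝ≥0∞) + s.value 0 u)
  else fbar1

end Round2

/-! ### The constrained search -/

/-- A search node: its state, the states of its successive ancestors (parent first), its cost `g`
and the estimate `f` computed when it was generated. -/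
structure Node (S : Type*) where
  state : S
  anc : List S
  g : Fin 2 → ℝ≥0
  f : Fin 2 → ℝ≥0∞

/-- The data private to one constrained search: the open list, and `g_min`. -/
structure Search (S : Type*) where
  opn : Multiset (Node S)
  gmin : S → ℝ≥0∞

/-- The state of the second phase: the shared lower bounds `h` and upper bounds `ub` (indexed by
direction and attribute), the complementary primary-cost paths found in the initialisation phase,
the shared bound `fbar1`, the solution pair with its secondary cost, and the two searches. -/
structure Main (S : Type*) where
  h : Dir → Fin 2 → S → ℝ≥0∞
  ub : Dir → Fin 2 → S → ℝ≥0∞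
  comp : Dir → S → List S
  fbar1 : ℝ≥0∞
  fsol2 : ℝ≥0∞
  sol : Option (Node S) × Option (Node S)
  search : Dir → Search S

/-- What the algorithm returns: the solution pair, with the complementary paths from which the
solution path is recovered. -/
structure Output (S : Type*) where
  sol : Option (Node S) × Option (Node S)
  comp : Dir → S → List S

namespace Main

variable {S : Type*}

/-- The global upper bounds. -/
def fbar (P : Instance S) (M : Main S) (i : Fin 2) : ℝ≥0∞ :=
  if i = 0 then M.fbar1 else (P.W : ℝ≥0∞)

def toOutput (M : Main S) : Output S := ⟨M.sol, M.comp⟩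

/-- The beginning of the second phase: bounds from the four preliminary searches, an empty
solution, and one node per search. -/
def init (P : Instance S) (R : Round2 S) : Main S :=
  let h : Dir → Fin 2 → S → ℝ≥0∞ := fun d i => match d with
    | .fwd => if i = 0 then R.back1.value 0 else R.r.back2.value 1
    | .bwd => if i = 0 then R.r.fwd1.value 0 else R.fwd2.value 1
  let ub : Dir → Fin 2 → S → ℝ≥0∞ := fun d i => match d with
    | .fwd => if i = 0 then R.r.back2.value 0 else R.back1.value 1
    | .bwd => if i = 0 then R.fwd2.value 0 else R.r.fwd1.value 1
  { h := h
    ub := ub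
    comp := fun d => match d with
      | .fwd => R.back1.route
      | .bwd => R.fwd2.route
    fbar1 := R.r.fbar1
    fsol2 := ⊤
    sol := (none, none)
    search := fun d =>
      { opn := {⟨P.initial d, [], 0, fun i => h d i (P.initial d)⟩}
        gmin := fun _ => ⊤ } }

/-- `x` is in the open list of direction `d`, with lexicographically smallest `(f_p, f_s)`. -/
def IsLeast (M : Main S) (d : Dir) (x : Node S) : Prop :=
  x ∈ (M.search d).opn ∧ ∀ y ∈ (M.search d).opn,
    toLex (x.f d.pri, x.f d.sec) ≤ toLex (y.f d.pri, y.f d.sec)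

open scoped Classical in
/-- Remove `x` from the open list of direction `d`. -/
def pop (M : Main S) (d : Dir) (x : Node S) : Main S :=
  { M with
    search := fun d' =>
      if d' = d then { M.search d with opn := (M.search d).opn.erase x } else M.search d' }

open scoped Classical in
/-- Heuristic tuning with the first expanded path: at the first expansion of a state, the lower
bound of the opposite direction on the primary attribute and its companion upper bound on the
secondary attribute are replaced by the costs of `x`. -/
def tune (M : Main S) (d : Dir) (x : Node S) : Main S :=
  if (M.search d).gmin x.state = ⊤ then
    { M with
      h := fun d' i v =>
        if d' = d.opp ∧ i = d.pri ∧ v = x.state then (x.g d.pri : ℝ≥0∞) else M.h d' i v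
      ub := fun d' i v =>
        if d' = d.opp ∧ i = d.sec ∧ v = x.state then (x.g d.sec : ℝ≥0∞) else M.ub d' i v }
  else M

open scoped Classical in
/-- Set `g_min` of the state of `x` to the secondary cost of `x`. -/
def setGmin (M : Main S) (d : Dir) (x : Node S) : Main S :=
  { M with
    search := fun d' =>
      if d' = d then
        { M.search d with
          gmin := fun v =>
            if v = x.state then (x.g d.sec : ℝ≥0∞) else (M.search d).gmin v }
      else M.search d' }

open scoped Classical in
/-- Early solution update. `(lo 0, hi 1)` and `(hi 0, lo 1)` are the costs of the two paths obtained
by joining `x` with the path behind `(h₁, ub₂)`, respectively behind `(ub₁, h₂)`. The join with the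
path that is best in the primary attribute is a tentative solution if it is valid; if it is
not, the other join, if valid, may still decrease the upper bound on `cost₁`. -/
def esu (P : Instance S) (M : Main S) (d : Dir) (x : Node S) : Main S :=
  let lo : Fin 2 → ℝ≥0∞ := fun i => (x.g i : ℝ≥0∞) + M.h d i x.state
  let hi : Fin 2 → ℝ≥0∞ := fun i => (x.g i : ℝ≥0∞) + M.ub d i x.state
  match d with
  | .fwd =>
    if hi 1 ≤ (P.W : ℝ≥0∞) then
      if lo 0 < M.fbar1 ∨ hi 1 < M.fsol2 then
        { M with fbar1 := lo 0, fsol2 := hi 1, sol := (some x, none) }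
      else M
    else if lo 1 ≤ (P.W : ℝ≥0∞) ∧ hi 0 < M.fbar1 then
      { M with fbar1 := hi 0, fsol2 := ⊤ }
    else M
  | .bwd =>
    if hi 0 ≤ M.fbar1 then
      if hi 0 < M.fbar1 ∨ lo 1 < M.fsol2 then
        { M with fbar1 := hi 0, fsol2 := lo 1, sol := (none, some x) }
      else M
    else if hi 1 ≤ (P.W : ℝ≥0∞) ∧ lo 0 < M.fbar1 then
      { M with fbar1 := lo 0, fsol2 := ⊤ }
    else M

/-- The node obtained by extending `x` to the state `v` in direction `d`. -/
def child (P : Instance S) (M : Main S) (d : Dir) (x : Node S) (v : S) : Node S :=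
  { state := v
    anc := x.state :: x.anc
    g := x.g + P.arcCost d x.state v
    f := fun i => ((x.g i + P.arcCost d x.state v i : ℝ≥0) : ℝ≥0∞) + M.h d i v }

/-- The new node `y` is not pruned: not by the last expanded node of its state, not by the upper
bounds of its state, and not by the global upper bounds. -/
def Keep (P : Instance S) (M : Main S) (d : Dir) (y : Node S) : Prop :=
  (y.g d.sec : ℝ≥0∞) < (M.search d).gmin y.state ∧
    (∀ i, (y.g i : ℝ≥0∞) ≤ M.ub d.opp i y.state) ∧ ∀ i, y.f i ≤ M.fbar P i

open scoped Classical in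
/-- Expand and prune: add the unpruned extensions of `x` to the open list. -/
def exp [Fintype S] (P : Instance S) (M : Main S) (d : Dir) (x : Node S) : Main S :=
  { M with
    search := fun d' =>
      if d' = d then
        { M.search d with
          opn := (M.search d).opn +
            ((Finset.univ.filter (fun v : S => P.arc d x.state v ∧
              Keep P M d (child P M d x v))).val.map (child P M d x)) }
      else M.search d' }

open scoped Classical in
/-- The exploration of a node which is neither out of bounds nor weakly dominated. -/
def explore [Fintype S] (P : Instance S) (M : Main S) (d : Dir) (x : Node S) : Main S :=
  let M' := ((M.tune d x).setGmin d x).esu P d x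
  if M'.h d d.pri x.state = M'.ub d d.pri x.state then M' else M'.exp P d x

open scoped Classical in
/-- One iteration of the search in direction `d`, for the extracted node `x` with
`f_p(x)` within its bound. The test on `f_s(x)` is made in the backward search only. -/
def iterate [Fintype S] (P : Instance S) (M : Main S) (d : Dir) (x : Node S) : Main S :=
  let M' := M.pop d x
  if d = .bwd ∧ M'.fbar P d.sec < x.f d.sec then M'
  else if (M'.search d).gmin x.state ≤ (x.g d.sec : ℝ≥0∞) then M'
  else M'.explore P d x

end Main

/-! ### The whole algorithm -/

/-- The configurations of the algorithm. -/
inductive Config (S : Type*)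
  | round1 (r : Round1 S)
  | round2 (r : Round2 S)
  | main (M : Main S)
  | returned (out : Output S)

/-- The initial configuration. -/
def initConfig {S : Type*} (P : Instance S) : Config S :=
  .round1 ⟨HSearch.init P.goal Set.univ, HSearch.init P.start Set.univ, ⊤⟩

open scoped Classical in
/-- The steps of the algorithm, with heuristics `e₂` and `e₁` for the two searches of round one.
The two parallel searches of each phase are interleaved in an arbitrary way: a step is one
iteration of one of them, and an extraction may choose any least element of the queue. -/
inductive Step {S : Type*} [Fintype S] (P : Instance S) (e₁ e₂ : S → ℝ≥0) :
    Config S → Config S → Prop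
  | back2_expand (r : Round1 S) (u : S) (l : Label S)
      (hu : r.back2.CanExpand 1 (fun v => (e₂ v : ℝ≥0∞)) (P.W : ℝ≥0∞) u l) :
      Step P e₁ e₂ (.round1 r)
        (.round1 { r with
          back2 := r.back2.expand P .bwd 1 Set.univ u l
          fbar1 := if u = P.start then (l.cost 0 : ℝ≥0∞) else r.fbar1 })
  | back2_finish (r : Round1 S)
      (hr : r.back2.CanFinish 1 (fun v => (e₂ v : ℝ≥0∞)) (P.W : ℝ≥0∞)) :
      Step P e₁ e₂ (.round1 r) (.round1 { r with back2 := r.back2.finish })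
  | fwd1_expand (r : Round1 S) (u : S) (l : Label S)
      (hu : r.fwd1.CanExpand 0 (fun v => (e₁ v : ℝ≥0∞)) r.fbar1 u l) :
      Step P e₁ e₂ (.round1 r)
        (.round1 { r with fwd1 := r.fwd1.expand P .fwd 0 Set.univ u l })
  | fwd1_finish (r : Round1 S)
      (hr : r.fwd1.CanFinish 0 (fun v => (e₁ v : ℝ≥0∞)) r.fbar1) :
      Step P e₁ e₂ (.round1 r) (.round1 { r with fwd1 := r.fwd1.finish })
  | to_round2 (r : Round1 S) (hb : r.back2.finished) (hf : r.fwd1.finished) :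
      Step P e₁ e₂ (.round1 r)
        (.round2 ⟨r, HSearch.init P.start (Round2.allowed r),
          HSearch.init P.goal (Round2.allowed r)⟩)
  | fwd2_expand (R : Round2 S) (u : S) (l : Label S)
      (hu : R.fwd2.CanExpand 1 (R.r.back2.value 1) (P.W : ℝ≥0∞) u l) :
      Step P e₁ e₂ (.round2 R)
        (.round2 { R with
          r := { R.r with fbar1 := Round2.matching P R.r.back2 u l R.r.fbar1 }
          fwd2 := R.fwd2.expand P .fwd 1 (Round2.allowed R.r) u l })
  | fwd2_finish (R : Round2 S)
      (hR : R.fwd2.CanFinish 1 (R.r.back2.value 1) (P.W : ℝ≥0∞)) :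
      Step P e₁ e₂ (.round2 R) (.round2 { R with fwd2 := R.fwd2.finish })
  | back1_expand (R : Round2 S) (u : S) (l : Label S)
      (hu : R.back1.CanExpand 0 (R.r.fwd1.value 0) R.r.fbar1 u l) :
      Step P e₁ e₂ (.round2 R)
        (.round2 { R with
          r := { R.r with fbar1 := Round2.matching P R.r.fwd1 u l R.r.fbar1 }
          back1 := R.back1.expand P .bwd 0 (Round2.allowed R.r) u l })
  | back1_finish (R : Round2 S)
      (hR : R.back1.CanFinish 0 (R.r.fwd1.value 0) R.r.fbar1) :
      Step P e₁ e₂ (.round2 R) (.round2 { R with back1 := R.back1.finish })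
  | to_main (R : Round2 S) (hf : R.fwd2.finished) (hb : R.back1.finished) :
      Step P e₁ e₂ (.round2 R) (.main (Main.init P R))
  | iterate (M : Main S) (d : Dir) (x : Node S) (hx : M.IsLeast d x)
      (hf : x.f d.pri ≤ M.fbar P d.pri) :
      Step P e₁ e₂ (.main M) (.main (M.iterate P d x))
  | stop_bound (M : Main S) (d : Dir) (x : Node S) (hx : M.IsLeast d x)
      (hf : M.fbar P d.pri < x.f d.pri) :
      Step P e₁ e₂ (.main M) (.returned M.toOutput)
  | stop_empty (M : Main S) (d : Dir) (ho : (M.search d).opn = 0) :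
      Step P e₁ e₂ (.main M) (.returned M.toOutput)

/-- A configuration that some run of the algorithm reaches. -/
def Reachable {S : Type*} [Fintype S] (P : Instance S) (e₁ e₂ : S → ℝ≥0) (c : Config S) : Prop :=
  Relation.ReflTransGen (Step P e₁ e₂) (initConfig P) c

/-- The returned solution pair holds exactly one node, and `π` is the start-goal sequence recovered
from it: the chain of parents of the node, joined with the complementary path of its state. -/
def Output.Represents {S : Type*} (out : Output S) (π : List S) : Prop :=
  (∃ x, out.sol = (some x, none) ∧
    π = (x.state :: x.anc).reverse ++ (out.comp .fwd x.state).tail) ∨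
  (∃ x, out.sol = (none, some x) ∧
    π = (out.comp .bwd x.state).reverse ++ x.anc)

end WCSPP

end

/-!
A bounded A* with a consistent heuristic expands states along shortest paths, so a finished one has
found lexicographically smallest paths to all states whose estimate is within its bound. As every
finite value of `fbar1` is attained by a feasible path, no bound ever cuts off an optimal path: all
states of optimal paths survive both rounds, with exact bounds on the primary attribute.

In the constrained search, call a part of an optimal path covered if a node at least as good in the
secondary attribute has been expanded in its end state. Until an optimal solution is recorded, each
part of an optimal path is either covered or has an open node on it, with an estimate within the
bounds, and neither search covers a whole optimal path; hence neither can stop. The first node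
expanded in a state of an optimal path is cheapest in the primary attribute, which is why tuning
with its costs keeps the lower bounds valid.

For termination, the costs of paths form a finitely generated submonoid of the nonnegative reals,
which is partially well-ordered even if some edges cost nothing. Each iteration lowers a value of
`g_min` or consumes an open node.
-/

noncomputable section

namespace WCSPP

/-! ### Directions and lexicographic costs -/

namespace Dir

@[simp] theorem opp_opp (d : Dir) : d.opp.opp = d := by cases d <;> rfl
@[simp] theorem opp_pri (d : Dir) : d.opp.pri = d.sec := by cases d <;> rfl
@[simp] theorem opp_sec (d : Dir) : d.opp.sec = d.pri := by cases d <;> rfl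
@[simp] theorem opp_ne (d : Dir) : d.opp ≠ d := by cases d <;> simp [opp]
@[simp] theorem ne_opp (d : Dir) : d ≠ d.opp := d.opp_ne.symm
@[simp] theorem pri_ne_sec (d : Dir) : d.pri ≠ d.sec := by cases d <;> simp [pri, sec]
@[simp] theorem sec_ne_pri (d : Dir) : d.sec ≠ d.pri := d.pri_ne_sec.symm

theorem other_pri (d : Dir) : other d.pri = d.sec := by cases d <;> rfl

theorem eq_pri_or_eq_sec (d : Dir) (i : Fin 2) : i = d.pri ∨ i = d.sec := by
  cases d <;> fin_cases i <;> simp [pri, sec]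

theorem eq_or_eq_opp (d d' : Dir) : d' = d ∨ d' = d.opp := by
  cases d <;> cases d' <;> simp [opp]

end Dir

/-- The cost `c`, to be compared lexicographically with attribute `p` first. -/
def lexCost (p : Fin 2) (c : Fin 2 → ℝ≥0) : ℝ≥0 ×ₗ ℝ≥0 := toLex (c p, c (other p))

section LexCost

variable {p : Fin 2} {a b : Fin 2 → ℝ≥0}

theorem lexCost_add (p : Fin 2) (a b : Fin 2 → ℝ≥0) :
    lexCost p (a + b) = lexCost p a + lexCost p b := rfl

theorem lexCost_le_lexCost :
    lexCost p a ≤ lexCost p b ↔ a p < b p ∨ a p = b p ∧ a (other p) ≤ b (other p) :=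
  Prod.Lex.toLex_le_toLex

theorem apply_le_of_lexCost_le (h : lexCost p a ≤ lexCost p b) : a p ≤ b p :=
  Prod.Lex.monotone_fst _ _ h

theorem toLex_coe_add_le_toLex_coe_add {x : ℝ≥0∞} (hx : x ≠ ⊤) :
    toLex ((a p : ℝ≥0∞) + x, (a (other p) : ℝ≥0∞)) ≤
      toLex ((b p : ℝ≥0∞) + x, (b (other p) : ℝ≥0∞)) ↔ lexCost p a ≤ lexCost p b := by
  simp only [lexCost_le_lexCost, Prod.Lex.toLex_le_toLex, ENNReal.add_lt_add_iff_right hx,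
    ENNReal.add_left_inj hx, ENNReal.coe_lt_coe, ENNReal.coe_inj, ENNReal.coe_le_coe]

end LexCost

/-! ### Trails -/

section Trails

variable {S : Type*} (P : Instance S)

@[simp] theorem Instance.arc_opp (d : Dir) (u v : S) : P.arc d.opp u v ↔ P.arc d v u := by
  cases d <;> rfl

@[simp] theorem Instance.arcCost_opp (d : Dir) (u v : S) :
    P.arcCost d.opp u v = P.arcCost d v u := by
  cases d <;> rfl

/-- `P.Trail d A u l c`: the list `l` leads from `u` back to the initial state of direction `d`
inside `A`, and the path obtained by reversing it has cost `c`. This is the order in which labels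
and nodes store their paths. -/
inductive Instance.Trail (d : Dir) (A : Set S) : S → List S → (Fin 2 → ℝ≥0) → Prop
  | root (h : P.initial d ∈ A) : Instance.Trail d A (P.initial d) [P.initial d] 0
  | step {u v : S} {l : List S} {c : Fin 2 → ℝ≥0} (t : Instance.Trail d A u l c)
      (h : P.arc d u v) (hv : v ∈ A) : Instance.Trail d A v (v :: l) (c + P.arcCost d u v)

/-- The state `u` is reached inside `A` by a path of cost `c` from the initial state of
direction `d`. -/
def Instance.Reach (d : Dir) (A : Set S) (u : S) (c : Fin 2 → ℝ≥0) : Prop :=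
  ∃ l, P.Trail d A u l c

variable {P} {d : Dir} {A B : Set S} {u v : S} {l l' : List S} {a b c : Fin 2 → ℝ≥0}

namespace Instance

theorem Trail.reach (t : P.Trail d A u l c) : P.Reach d A u c := ⟨l, t⟩

theorem Trail.mono (t : P.Trail d A u l c) (h : A ⊆ B) : P.Trail d B u l c := by
  induction t with
  | root h' => exact .root (h h')
  | step _ ha hv ih => exact .step ih ha (h hv)

theorem Reach.mono (t : P.Reach d A u c) (h : A ⊆ B) : P.Reach d B u c :=
  let ⟨l, t⟩ := t; ⟨l, t.mono h⟩

theorem Reach.univ (t : P.Reach d A u c) : P.Reach d Set.univ u c := t.mono (Set.subset_univ A)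

theorem Trail.mem (t : P.Trail d A u l c) : u ∈ A := by
  cases t <;> assumption

theorem Reach.mem (t : P.Reach d A u c) : u ∈ A := let ⟨_, t⟩ := t; t.mem

theorem Reach.root (h : P.initial d ∈ A) : P.Reach d A (P.initial d) 0 := ⟨_, .root h⟩

theorem Reach.step (t : P.Reach d A u c) (h : P.arc d u v) (hv : v ∈ A) :
    P.Reach d A v (c + P.arcCost d u v) :=
  let ⟨_, t⟩ := t; ⟨_, t.step h hv⟩

theorem Trail.step_opp (t : P.Trail d.opp A v l b) (h : P.arc d u v) (hu : u ∈ A) :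
    P.Trail d.opp A u (u :: l) (b + P.arcCost d u v) := by
  simpa using t.step ((P.arc_opp d v u).2 h) hu

theorem Reach.step_opp (t : P.Reach d.opp A v b) (h : P.arc d u v) (hu : u ∈ A) :
    P.Reach d.opp A u (b + P.arcCost d u v) :=
  let ⟨_, t⟩ := t; ⟨_, t.step_opp h hu⟩

theorem Trail.cons_tail (t : P.Trail d A u l c) : u :: l.tail = l := by
  cases t <;> rfl

theorem Trail.append (t : P.Trail d A u l a) (t' : P.Trail d.opp A u l' b) :
    P.Trail d.opp A (P.initial d) (l.reverse ++ l'.tail) (a + b) := by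
  induction t generalizing l' b with
  | root _ => simpa [t'.cons_tail] using t'
  | @step u v l c t ha _ ih =>
    simpa [t'.cons_tail, add_assoc, add_comm, add_left_comm] using ih (t'.step_opp ha t.mem)

theorem Reach.join (t : P.Reach d Set.univ u a) (t' : P.Reach d.opp Set.univ u b) :
    P.Reach .bwd Set.univ P.start (a + b) := by
  obtain ⟨l, t⟩ := t
  obtain ⟨l', t'⟩ := t'
  cases d with
  | fwd => exact (t.append t').reach
  | bwd => exact add_comm b a ▸ (t'.append t).reach

theorem Trail.isPath (t : P.Trail d.opp A u l c) :
    P.IsPath d u (P.target d) l ∧ P.pathCost d l = c := by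
  induction t with
  | root _ => exact ⟨⟨rfl, rfl, List.isChain_singleton _⟩, rfl⟩
  | @step u v l c t ha _ ih =>
    obtain ⟨⟨h1, h2, h3⟩, h4⟩ := ih
    rw [← t.cons_tail] at h1 h2 h3 h4 ⊢
    refine ⟨⟨rfl, by simpa using h2, ?_⟩, ?_⟩
    · exact List.isChain_cons_cons.2 ⟨(P.arc_opp d u v).1 ha, h3⟩
    · rw [pathCost, h4, P.arcCost_opp d u v, add_comm]

theorem IsPath.trail (h : P.IsPath d u (P.target d) l) :
    P.Trail d.opp Set.univ u l (P.pathCost d l) := by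
  induction l generalizing u with
  | nil => simp [IsPath] at h
  | cons x l ih =>
    obtain ⟨h1, h2, h3⟩ := h
    obtain rfl : x = u := by simpa using h1
    cases l with
    | nil =>
      obtain rfl : x = P.target d := by simpa using h2
      exact .root (Set.mem_univ _)
    | cons y l =>
      obtain ⟨h3, h4⟩ := List.isChain_cons_cons.1 h3
      rw [pathCost, add_comm]
      exact (ih ⟨rfl, by simpa using h2, h4⟩).step_opp h3 (Set.mem_univ _)

end Instance

end Trails

/-! ### Bounded A* -/

namespace HSearch

variable {S : Type*} {P : Instance S} {d : Dir} {p : Fin 2} {A : Set S} {e : S → ℝ≥0∞}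
  {s : HSearch S} {u v : S} {l : Label S} {c : Fin 2 → ℝ≥0} {bound bound' : ℝ≥0∞}

variable (p) in
/-- The state `v` has a label whose cost is at most `c` in the `(p, other p)` order. -/
def LabelLE (s : HSearch S) (v : S) (c : Fin 2 → ℝ≥0) : Prop :=
  ∃ m, s.label v = some m ∧ lexCost p m.cost ≤ lexCost p c

variable (P d p A) in
/-- The invariant of a bounded A* in direction `d` on attribute `p` restricted to `A`: labels are
costs of paths, those of expanded states are smallest, and they have been propagated. -/
structure Inv (s : HSearch S) : Prop where
  trail : ∀ u l, s.label u = some l → P.Trail d A u l.path l.cost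
  label_closed : ∀ u ∈ s.closed, ∃ l, s.label u = some l
  closed_le : ∀ u ∈ s.closed, ∀ l, s.label u = some l → ∀ c, P.Reach d A u c →
    lexCost p l.cost ≤ lexCost p c
  succ : ∀ u ∈ s.closed, ∀ l, s.label u = some l → ∀ v ∈ A, P.arc d u v →
    s.LabelLE p v (l.cost + P.arcCost d u v)
  root : P.initial d ∈ A → s.LabelLE p (P.initial d) 0

variable (P d p A e) in
/-- If the search has finished, it has expanded all states whose estimate is within the bound. -/
def Complete (bound : ℝ≥0∞) (s : HSearch S) : Prop :=
  s.finished → ∀ v c, P.Reach d A v c → (c p : ℝ≥0∞) + e v ≤ bound → v ∈ s.closed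

variable (P d p A e) in
/-- The heuristic `e` is finite and consistent on `A`. -/
structure ConsistentOn : Prop where
  ne_top : ∀ u ∈ A, e u ≠ ⊤
  le_add : ∀ u ∈ A, ∀ v ∈ A, P.arc d u v → e u ≤ (P.arcCost d u v p : ℝ≥0∞) + e v

theorem Complete.mono (h : Complete P d p A e bound s) (hb : bound' ≤ bound) :
    Complete P d p A e bound' s :=
  fun hs v c hv hc => h hs v c hv (hc.trans hb)

theorem init_inv : Inv P d p A (init (P.initial d) A) where
  trail u l h := by
    simp only [init] at h
    split_ifs at h with h'
    obtain ⟨rfl, hu⟩ := h'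
    cases h
    exact .root hu
  label_closed u hu := by simp [init] at hu
  closed_le u hu := by simp [init] at hu
  succ u hu := by simp [init] at hu
  root h := ⟨⟨0, [P.initial d]⟩, by simp [init, h], le_rfl⟩

/-- Follow the path while its states are expanded: the first one which is not has received a label
from its predecessor, and consistency makes the estimates increase from there on. -/
theorem Inv.closed_or_open (h : Inv P d p A s) (he : ConsistentOn P d p A e)
    (hv : P.Reach d A v c) :
    v ∈ s.closed ∨ ∃ w m, s.IsOpen w m ∧
      key p e w m ≤ toLex ((c p : ℝ≥0∞) + e v, (c (other p) : ℝ≥0∞)) := by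
  obtain ⟨l, t⟩ := hv
  induction t with
  | root hA =>
    obtain ⟨m, hm, hc⟩ := h.root hA
    refine or_iff_not_imp_left.2 fun hr => ⟨_, m, ⟨hm, hr⟩, ?_⟩
    exact (toLex_coe_add_le_toLex_coe_add (he.ne_top _ hA)).2 hc
  | @step u v l c t ha hv ih =>
    have hu := t.reach
    rcases ih with ih | ⟨w, m, hw, hk⟩
    · obtain ⟨l, hl⟩ := h.label_closed u ih
      obtain ⟨m, hm, hc⟩ := h.succ u ih l hl v hv ha
      refine or_iff_not_imp_left.2 fun hr => ⟨_, m, ⟨hm, hr⟩, ?_⟩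
      refine (toLex_coe_add_le_toLex_coe_add (he.ne_top _ hv)).2 (hc.trans ?_)
      simpa only [lexCost_add] using add_le_add_left (h.closed_le u ih l hl c hu) _
    · refine Or.inr ⟨w, m, hw, hk.trans (Prod.Lex.toLex_mono ⟨?_, by simp⟩)⟩
      calc (c p : ℝ≥0∞) + e u ≤ c p + (P.arcCost d u v p + e v) := by
            gcongr; exact he.le_add u hu.mem v hv ha
        _ = _ := by simp [add_assoc]

theorem Inv.cost_le_of_isLeast (h : Inv P d p A s) (he : ConsistentOn P d p A e)
    (hl : s.IsLeast p e u l) (hc : P.Reach d A u c) : lexCost p l.cost ≤ lexCost p c := by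
  rcases h.closed_or_open he hc with hu | ⟨w, m, hw, hk⟩
  · exact absurd hu hl.1.2
  · exact (toLex_coe_add_le_toLex_coe_add (he.ne_top u hc.mem)).1 ((hl.2 w m hw).trans hk)

theorem expand_label_of_mem (hv : v ∈ insert u s.closed) :
    (s.expand P d p A u l).label v = s.label v := by
  simp only [expand]
  exact if_neg fun h => h.2.2.1 hv

theorem LabelLE.expand (h : s.LabelLE p v c) : (s.expand P d p A u l).LabelLE p v c := by
  obtain ⟨m, hm, hmc⟩ := h
  simp only [LabelLE, HSearch.expand]
  split_ifs with hc
  · exact ⟨_, rfl, (hc.2.2.2 m hm).le.trans hmc⟩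
  · exact ⟨m, hm, hmc⟩

theorem expand_labelLE_of_arc (ha : P.arc d u v) (hv : v ∈ A) (hc : v ∉ insert u s.closed) :
    (s.expand P d p A u l).LabelLE p v (l.cost + P.arcCost d u v) := by
  by_cases hlt : ∀ old, s.label v = some old →
      lexCost p (l.cost + P.arcCost d u v) < lexCost p old.cost
  · exact ⟨_, if_pos ⟨ha, hv, hc, hlt⟩, le_rfl⟩
  · push Not at hlt
    obtain ⟨old, ho, hle⟩ := hlt
    exact LabelLE.expand ⟨old, ho, hle⟩

theorem Inv.expand_succ (h : Inv P d p A s) (he : ConsistentOn P d p A e)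
    (hl : s.IsLeast p e u l) (ha : P.arc d u v) (hv : v ∈ A) :
    (s.expand P d p A u l).LabelLE p v (l.cost + P.arcCost d u v) := by
  have hr : P.Reach d A v (l.cost + P.arcCost d u v) := ((h.trail u l hl.1.1).step ha hv).reach
  by_cases hc : v ∈ insert u s.closed
  · refine LabelLE.expand ?_
    rcases hc with rfl | hc
    · exact ⟨l, hl.1.1, h.cost_le_of_isLeast he hl hr⟩
    · obtain ⟨m, hm⟩ := h.label_closed v hc
      exact ⟨m, hm, h.closed_le v hc m hm _ hr⟩
  · exact expand_labelLE_of_arc ha hv hc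

theorem Inv.expand (h : Inv P d p A s) (he : ConsistentOn P d p A e)
    (hl : s.IsLeast p e u l) : Inv P d p A (s.expand P d p A u l) where
  trail v m hm := by
    simp only [HSearch.expand] at hm
    split_ifs at hm with hc
    · cases hm
      exact (h.trail u l hl.1.1).step hc.1 hc.2.1
    · exact h.trail v m hm
  label_closed v hv := by
    rw [expand_label_of_mem hv]
    rcases hv with rfl | hv
    exacts [⟨l, hl.1.1⟩, h.label_closed v hv]
  closed_le v hv m hm c hc := by
    rw [expand_label_of_mem hv] at hm
    rcases hv with rfl | hv
    · obtain rfl : l = m := Option.some.inj (hl.1.1.symm.trans hm)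
      exact h.cost_le_of_isLeast he hl hc
    · exact h.closed_le v hv m hm c hc
  succ v hv m hm w hw ha := by
    rw [expand_label_of_mem hv] at hm
    rcases hv with rfl | hv
    · obtain rfl : l = m := Option.some.inj (hl.1.1.symm.trans hm)
      exact h.expand_succ he hl ha hw
    · exact (h.succ v hv m hm w hw ha).expand
  root hr := (h.root hr).expand

theorem Inv.finish (h : Inv P d p A s) : Inv P d p A s.finish :=
  ⟨h.trail, h.label_closed, h.closed_le, h.succ, h.root⟩

theorem complete_of_not_finished (hs : ¬ s.finished) : Complete P d p A e bound s :=
  fun h => absurd h hs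

theorem Inv.complete_finish (h : Inv P d p A s) (he : ConsistentOn P d p A e)
    (hf : s.CanFinish p e bound) : Complete P d p A e bound s.finish := by
  intro _ v c hv hc
  refine (h.closed_or_open he hv).resolve_right ?_
  rintro ⟨w, m, hw, hk⟩
  rcases hf.2 with hn | ⟨u, l, hl, hb⟩
  · exact hn w m hw
  · exact hb.not_ge ((Prod.Lex.monotone_fst _ _ ((hl.2 w m hw).trans hk)).trans hc)

theorem mem_closed_of_value_ne_top {i : Fin 2} (hu : s.value i u ≠ ⊤) : u ∈ s.closed := by
  by_contra hc
  simp [value, hc] at hu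

theorem Inv.exists_value_eq (h : Inv P d p A s) (hu : u ∈ s.closed) :
    ∃ a, P.Trail d A u (s.route u) a ∧ (∀ i, s.value i u = a i) ∧
      ∀ c, P.Reach d A u c → lexCost p a ≤ lexCost p c := by
  obtain ⟨l, hl⟩ := h.label_closed u hu
  refine ⟨l.cost, ?_, fun i => by simp [value, hu, hl], h.closed_le u hu l hl⟩
  simpa [route, hl] using h.trail u l hl

theorem Inv.value_le_add (h : Inv P d.opp p A s) (hu : u ∈ s.closed) (hv : v ∈ s.closed)
    (huA : u ∈ A) (ha : P.arc d u v) :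
    s.value p u ≤ (P.arcCost d u v p : ℝ≥0∞) + s.value p v := by
  obtain ⟨a, -, hua, hle⟩ := h.exists_value_eq hu
  obtain ⟨b, hb, hvb, -⟩ := h.exists_value_eq hv
  rw [hua, hvb, add_comm]
  exact_mod_cast apply_le_of_lexCost_le (hle _ (hb.reach.step_opp ha huA))

theorem Inv.consistentOn (h : Inv P d.opp p A s) {B : Set S} (hB : B ⊆ s.closed) (hBA : B ⊆ A) :
    ConsistentOn P d p B (s.value p) where
  ne_top u hu := by
    obtain ⟨a, -, ha, -⟩ := h.exists_value_eq (hB hu)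
    exact ha p ▸ ENNReal.coe_ne_top
  le_add u hu v hv := h.value_le_add (hB hu) (hB hv) (hBA hu)

end HSearch

/-! ### The optimal cost -/

namespace Instance

variable {S : Type*} (P : Instance S)

/-- `c` is the cost of a start-goal path within the weight limit. -/
def IsFeasibleCost (c : Fin 2 → ℝ≥0) : Prop := P.Reach .bwd Set.univ P.start c ∧ c 1 ≤ P.W

/-- `C` is the lexicographically smallest cost of a start-goal path within the weight limit. -/
structure IsOptimalCost (C : Fin 2 → ℝ≥0) : Prop where
  feasible : P.IsFeasibleCost C
  le : ∀ c, P.IsFeasibleCost c → lexCost 0 C ≤ lexCost 0 c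

/-- The bound `x` on `cost₁` is infinite or attained by a start-goal path within the weight
limit. -/
def IsAttained (x : ℝ≥0∞) : Prop := x = ⊤ ∨ ∃ c, P.IsFeasibleCost c ∧ x = c 0

/-- `u` lies on a start-goal path of cost `C`, after a part of cost `a` and before a part of
cost `b` in direction `d`. -/
structure Split (C : Fin 2 → ℝ≥0) (d : Dir) (u : S) (a b : Fin 2 → ℝ≥0) : Prop where
  left : P.Reach d Set.univ u a
  right : P.Reach d.opp Set.univ u b
  sum : a + b = C

/-- The additive monoid generated by the costs of the edges. -/
def costMonoid : AddSubmonoid ℝ≥0 :=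
  AddSubmonoid.closure (Set.range fun t : S × S × Fin 2 => P.cost t.1 t.2.1 t.2.2)

variable {P} {C a b c : Fin 2 → ℝ≥0} {d : Dir} {A : Set S} {u v : S} {π : List S} {x : ℝ≥0∞}

theorem IsOptimalCost.eq_of_le (hC : P.IsOptimalCost C) (hc : P.Reach .bwd Set.univ P.start c)
    (hle : c ≤ C) : c = C := by
  rcases lexCost_le_lexCost.1 (hC.le c ⟨hc, (hle 1).trans hC.feasible.2⟩) with h | ⟨h, k⟩
  · exact absurd h (hle 0).not_gt
  · exact le_antisymm hle (Fin.forall_fin_two.2 ⟨h.le, k⟩)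

theorem IsOptimalCost.le_of_isAttained (hC : P.IsOptimalCost C) (hx : P.IsAttained x) :
    (C 0 : ℝ≥0∞) ≤ x := by
  rcases hx with rfl | ⟨c, hc, rfl⟩
  · exact le_top
  · exact_mod_cast apply_le_of_lexCost_le (hC.le c hc)

theorem Split.symm (h : P.Split C d u a b) : P.Split C d.opp u b a :=
  ⟨h.right, by simpa using h.left, by rw [add_comm, h.sum]⟩

theorem Split.prev (h : P.Split C d v (a + P.arcCost d u v) b) (hu : P.Reach d Set.univ u a)
    (ha : P.arc d u v) : P.Split C d u a (b + P.arcCost d u v) :=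
  ⟨hu, h.right.step_opp ha (Set.mem_univ _), by rw [← h.sum]; abel⟩

theorem IsOptimalCost.eq_left (hC : P.IsOptimalCost C) (h : P.Split C d u a b)
    (hc : P.Reach d Set.univ u c) (hle : c ≤ a) : c = a := by
  refine add_right_cancel (b := b) ?_
  rw [h.sum]
  exact hC.eq_of_le (hc.join h.right) (h.sum ▸ add_le_add_left hle b)

theorem IsOptimalCost.eq_right (hC : P.IsOptimalCost C) (h : P.Split C d u a b)
    (hc : P.Reach d.opp Set.univ u c) (hle : c ≤ b) : c = b :=
  hC.eq_left h.symm hc hle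

theorem IsOptimalCost.split_target (hC : P.IsOptimalCost C) (d : Dir) :
    P.Split C d (P.target d) C 0 := by
  refine ⟨?_, .root (Set.mem_univ _), add_zero C⟩
  cases d with
  | bwd => exact hC.feasible.1
  | fwd =>
    obtain ⟨l, t⟩ := hC.feasible.1
    have := (t.append (d := .bwd) (.root (d := .fwd) (Set.mem_univ _))).reach
    rwa [add_zero] at this

theorem IsOptimalCost.split_initial (hC : P.IsOptimalCost C) (d : Dir) :
    P.Split C d (P.initial d) 0 C := by
  simpa [target] using (hC.split_target d.opp).symm

theorem arcCost_mem_costMonoid (d : Dir) (u v : S) (i : Fin 2) :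
    P.arcCost d u v i ∈ P.costMonoid := by
  cases d
  exacts [AddSubmonoid.subset_closure ⟨(u, v, i), rfl⟩,
    AddSubmonoid.subset_closure ⟨(v, u, i), rfl⟩]

theorem Reach.mem_costMonoid (h : P.Reach d A u c) (i : Fin 2) : c i ∈ P.costMonoid := by
  obtain ⟨l, t⟩ := h
  induction t with
  | root _ => exact zero_mem _
  | step _ _ _ ih => exact add_mem ih (arcCost_mem_costMonoid _ _ _ _)

theorem isPWO_costMonoid [Finite S] : (P.costMonoid : Set ℝ≥0).IsPWO :=
  Set.IsPWO.addSubmonoid_closure (fun _ _ => zero_le) (Set.finite_range _).isPWO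

theorem exists_isOptimalCost [Finite S] (h : ∃ c, P.IsFeasibleCost c) :
    ∃ C, P.IsOptimalCost C := by
  have hwf : (lexCost 0 '' {c | P.IsFeasibleCost c}).IsWF := by
    refine (((isPWO_costMonoid (P := P)).prod (isPWO_costMonoid (P := P))).image_of_monotone
      Prod.Lex.toLex_mono).isWF.mono ?_
    rintro _ ⟨c, hc, rfl⟩
    exact ⟨(c 0, c 1), ⟨hc.1.mem_costMonoid 0, hc.1.mem_costMonoid 1⟩, rfl⟩
  have hne : (lexCost 0 '' {c | P.IsFeasibleCost c}).Nonempty := Set.Nonempty.image _ h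
  obtain ⟨C, hC, hmin⟩ := hwf.min_mem hne
  exact ⟨C, hC, fun c hc => hmin.le.trans (hwf.min_le hne ⟨c, hc, rfl⟩)⟩

theorem IsFeasible.isFeasibleCost (h : P.IsFeasible π) :
    P.IsFeasibleCost (P.pathCost .fwd π) :=
  ⟨⟨π, IsPath.trail (d := .fwd) h.1⟩, h.2⟩

theorem Trail.isFeasible (h : P.Trail .bwd Set.univ P.start π c) (hc : c 1 ≤ P.W) :
    P.IsFeasible π ∧ P.pathCost .fwd π = c := by
  obtain ⟨hπ, rfl⟩ := h.isPath (d := .fwd)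
  exact ⟨⟨hπ, hc⟩, rfl⟩

theorem exists_isFeasible_iff : (∃ π, P.IsFeasible π) ↔ ∃ c, P.IsFeasibleCost c :=
  ⟨fun ⟨_, h⟩ => ⟨_, h.isFeasibleCost⟩, fun ⟨_, ⟨π, h⟩, hc⟩ => ⟨π, (h.isFeasible hc).1⟩⟩

theorem IsOptimalCost.isCostOptimal (hC : P.IsOptimalCost C)
    (h : P.Trail .bwd Set.univ P.start π C) : P.IsCostOptimal π := by
  obtain ⟨hπ, rfl⟩ := h.isFeasible hC.feasible.2
  exact ⟨hπ, fun π' h' => hC.le _ h'.isFeasibleCost⟩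

end Instance

/-! ### Soundness of the constrained search -/

namespace Main

variable {S : Type*} {P : Instance S} {C : Fin 2 → ℝ≥0} {M : Main S} {d d' : Dir} {x y : Node S}
  {u v : S} {a b : Fin 2 → ℝ≥0}

variable (P) in
/-- The node `x` of direction `d` carries the cost of its path and, with respect to the lower
bounds `h`, the right estimate on the primary attribute. -/
structure ValidNode (h : Dir → Fin 2 → S → ℝ≥0∞) (d : Dir) (x : Node S) : Prop where
  trail : P.Trail d Set.univ x.state (x.state :: x.anc) x.g
  f_pri : x.f d.pri = x.g d.pri + h d d.pri x.state

/-- The costs of the complementary path of `u` that is best in the primary attribute. -/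
def primary (M : Main S) (d : Dir) (u : S) (i : Fin 2) : ℝ≥0∞ :=
  if i = d.pri then M.h d i u else M.ub d i u

/-- The costs of the complementary path of `u` that is best in the secondary attribute. -/
def secondary (M : Main S) (d : Dir) (u : S) (i : Fin 2) : ℝ≥0∞ :=
  if i = d.pri then M.ub d i u else M.h d i u

@[simp] theorem primary_pri (M : Main S) (d : Dir) (u : S) :
    M.primary d u d.pri = M.h d d.pri u := by simp [primary]
@[simp] theorem primary_sec (M : Main S) (d : Dir) (u : S) :
    M.primary d u d.sec = M.ub d d.sec u := by simp [primary]
@[simp] theorem secondary_pri (M : Main S) (d : Dir) (u : S) :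
    M.secondary d u d.pri = M.ub d d.pri u := by simp [secondary]
@[simp] theorem secondary_sec (M : Main S) (d : Dir) (u : S) :
    M.secondary d u d.sec = M.h d d.sec u := by simp [secondary]

/-- The cost of the join of `x` with the primary complementary path of its state. -/
def primaryJoin (M : Main S) (d : Dir) (x : Node S) (i : Fin 2) : ℝ≥0∞ :=
  x.g i + M.primary d x.state i

/-- The cost of the join of `x` with the secondary complementary path of its state. -/
def secondaryJoin (M : Main S) (d : Dir) (x : Node S) (i : Fin 2) : ℝ≥0∞ :=
  x.g i + M.secondary d x.state i

/-- The solution pair holding the node `x` of direction `d`. -/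
def solOf (d : Dir) (x : Node S) : Option (Node S) × Option (Node S) :=
  match d with
  | .fwd => (some x, none)
  | .bwd => (none, some x)

variable (P) in
/-- All bounds, costs and solutions stem from paths. -/
structure Sound (M : Main S) : Prop where
  node : ∀ d, ∀ x ∈ (M.search d).opn, ValidNode P M.h d x
  primary : ∀ d u i, M.primary d u i ≠ ⊤ →
    ∃ b, P.Trail d.opp Set.univ u (M.comp d u) b ∧ ∀ j, M.primary d u j = b j
  secondary : ∀ d u i, M.secondary d u i ≠ ⊤ →
    ∃ b, P.Reach d.opp Set.univ u b ∧ ∀ j, M.secondary d u j = b j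
  attained : P.IsAttained M.fbar1
  sol : M.fsol2 ≠ ⊤ → ∃ π c, M.toOutput.Represents π ∧ P.Trail .bwd Set.univ P.start π c ∧
    M.fbar1 = c 0 ∧ M.fsol2 = c 1
  exists_feasible : M.sol ≠ (none, none) → ∃ c, P.IsFeasibleCost c

/-- The current solution has cost `C`. -/
def Solved (C : Fin 2 → ℝ≥0) (M : Main S) : Prop := M.fbar1 = C 0 ∧ M.fsol2 = C 1

theorem Sound.exists_primaryJoin_eq (h : Sound P M)
    (hx : P.Trail d Set.univ x.state (x.state :: x.anc) x.g) {i : Fin 2}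
    (hi : M.primaryJoin d x i ≠ ⊤) :
    ∃ π c, (Output.mk (solOf d x) M.comp).Represents π ∧ P.Trail .bwd Set.univ P.start π c ∧
      ∀ j, M.primaryJoin d x j = c j := by
  obtain ⟨b, hb, hj⟩ := h.primary d x.state i (ENNReal.add_ne_top.1 hi).2
  have hsum : ∀ j, M.primaryJoin d x j = ((x.g + b) j : ℝ≥0) := by simp [primaryJoin, hj]
  cases d with
  | fwd => exact ⟨_, x.g + b, Or.inl ⟨x, rfl, rfl⟩, hx.append hb, hsum⟩
  | bwd =>
    rw [add_comm] at hsum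
    exact ⟨_, b + x.g, Or.inr ⟨x, rfl, rfl⟩, hb.append hx, hsum⟩

theorem Sound.exists_secondaryJoin_eq (h : Sound P M) (hx : P.Reach d Set.univ x.state x.g)
    {i : Fin 2} (hi : M.secondaryJoin d x i ≠ ⊤) :
    ∃ c, P.Reach .bwd Set.univ P.start c ∧ ∀ j, M.secondaryJoin d x j = c j := by
  obtain ⟨b, hb, hj⟩ := h.secondary d x.state i (ENNReal.add_ne_top.1 hi).2
  exact ⟨x.g + b, hx.join hb, by simp [secondaryJoin, hj]⟩

/-- The extraction of `x` has already decided one of the two tests on the join with the primary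
path, which brings the two directions into a common form. -/
theorem esu_eq (hf : (x.g d.pri : ℝ≥0∞) + M.h d d.pri x.state ≤ M.fbar P d.pri) :
    M.esu P d x =
      if M.primaryJoin d x 1 ≤ P.W ∧ M.primaryJoin d x 0 ≤ M.fbar1 then
        if M.primaryJoin d x 0 < M.fbar1 ∨ M.primaryJoin d x 1 < M.fsol2 then
          { M with fbar1 := M.primaryJoin d x 0, fsol2 := M.primaryJoin d x 1, sol := solOf d x }
        else M
      else if M.secondaryJoin d x 1 ≤ P.W ∧ M.secondaryJoin d x 0 < M.fbar1 then
        { M with fbar1 := M.secondaryJoin d x 0, fsol2 := ⊤ }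
      else M := by
  cases d with
  | fwd =>
    have hpri : M.primaryJoin .fwd x 0 ≤ M.fbar1 := hf
    simp only [hpri, and_true]
    rfl
  | bwd =>
    have hpri : M.primaryJoin .bwd x 1 ≤ P.W := hf
    simp only [hpri, true_and]
    rfl

theorem Sound.esu (h : Sound P M) (hx : P.Trail d Set.univ x.state (x.state :: x.anc) x.g)
    (hf : (x.g d.pri : ℝ≥0∞) + M.h d d.pri x.state ≤ M.fbar P d.pri) :
    Sound P (M.esu P d x) := by
  rw [esu_eq hf]
  split_ifs with hp hlt hs
  · obtain ⟨π, c, hπ, ht, hc⟩ :=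
      h.exists_primaryJoin_eq hx (ne_top_of_le_ne_top ENNReal.coe_ne_top hp.1)
    have hfeas : P.IsFeasibleCost c := ⟨ht.reach, by simpa only [hc, ENNReal.coe_le_coe] using hp.1⟩
    exact ⟨h.node, h.primary, h.secondary, Or.inr ⟨c, hfeas, hc 0⟩,
      fun _ => ⟨π, c, hπ, ht, hc 0, hc 1⟩, fun _ => ⟨c, hfeas⟩⟩
  · exact h
  · obtain ⟨c, hr, hc⟩ :=
      h.exists_secondaryJoin_eq hx.reach (ne_top_of_le_ne_top ENNReal.coe_ne_top hs.1)
    have hfeas : P.IsFeasibleCost c := ⟨hr, by simpa only [hc, ENNReal.coe_le_coe] using hs.1⟩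
    exact ⟨h.node, h.primary, h.secondary, Or.inr ⟨c, hfeas, hc 0⟩, fun hn => absurd rfl hn,
      h.exists_feasible⟩
  · exact h

theorem Solved.esu (hs : Solved C M) (hC : P.IsOptimalCost C) (h : Sound P M)
    (hx : P.Trail d Set.univ x.state (x.state :: x.anc) x.g)
    (hf : (x.g d.pri : ℝ≥0∞) + M.h d d.pri x.state ≤ M.fbar P d.pri) :
    Solved C (M.esu P d x) := by
  rw [esu_eq hf]
  split_ifs with hp hlt hsec
  · obtain ⟨π, c, -, ht, hc⟩ :=
      h.exists_primaryJoin_eq hx (ne_top_of_le_ne_top ENNReal.coe_ne_top hp.1)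
    simp only [hc, hs.1, hs.2, ENNReal.coe_le_coe, ENNReal.coe_lt_coe] at hp hlt
    have hle := apply_le_of_lexCost_le (hC.le c ⟨ht.reach, hp.1⟩)
    have hlt : c 1 < C 1 := hlt.resolve_left hle.not_gt
    obtain rfl := hC.eq_of_le ht.reach (Fin.forall_fin_two.2 ⟨hp.2, hlt.le⟩)
    exact absurd hlt (lt_irrefl _)
  · exact hs
  · obtain ⟨c, hr, hc⟩ :=
      h.exists_secondaryJoin_eq hx.reach (ne_top_of_le_ne_top ENNReal.coe_ne_top hsec.1)
    simp only [hc, hs.1, ENNReal.coe_le_coe, ENNReal.coe_lt_coe] at hsec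
    exact absurd hsec.2 (apply_le_of_lexCost_le (hC.le c ⟨hr, hsec.1⟩)).not_gt
  · exact hs

theorem Sound.solved_of_le (h : Sound P M) (hC : P.IsOptimalCost C) (h0 : M.fbar1 ≤ C 0)
    (h1 : M.fsol2 ≤ C 1) : Solved C M := by
  obtain ⟨π, c, -, ht, hc0, hc1⟩ := h.sol (ne_top_of_le_ne_top ENNReal.coe_ne_top h1)
  rw [hc0, ENNReal.coe_le_coe] at h0
  rw [hc1, ENNReal.coe_le_coe] at h1
  obtain rfl := hC.eq_of_le ht.reach (Fin.forall_fin_two.2 ⟨h0, h1⟩)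
  exact ⟨hc0, hc1⟩

theorem solved_esu (hC : P.IsOptimalCost C) (h : Sound P M)
    (hx : P.Trail d Set.univ x.state (x.state :: x.anc) x.g)
    (hf : (x.g d.pri : ℝ≥0∞) + M.h d d.pri x.state ≤ M.fbar P d.pri)
    (hle : ∀ i, M.primaryJoin d x i ≤ C i) : Solved C (M.esu P d x) := by
  have hfbar : M.primaryJoin d x 0 ≤ M.fbar1 := (hle 0).trans (hC.le_of_isAttained h.attained)
  have hW : M.primaryJoin d x 1 ≤ P.W := (hle 1).trans (ENNReal.coe_le_coe.2 hC.feasible.2)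
  rw [esu_eq hf, if_pos ⟨hW, hfbar⟩]
  split_ifs with hlt
  · obtain ⟨π, c, -, ht, hc⟩ :=
      h.exists_primaryJoin_eq hx (ne_top_of_le_ne_top ENNReal.coe_ne_top hW)
    simp only [hc, ENNReal.coe_le_coe] at hle
    obtain rfl := hC.eq_of_le ht.reach hle
    exact ⟨hc 0, hc 1⟩
  · push Not at hlt
    exact h.solved_of_le hC (hlt.1.trans (hle 0)) (hlt.2.trans (hle 1))

@[simp] theorem esu_h : (M.esu P d x).h = M.h := by
  unfold esu; cases d <;> dsimp only <;> split_ifs <;> rfl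
@[simp] theorem esu_ub : (M.esu P d x).ub = M.ub := by
  unfold esu; cases d <;> dsimp only <;> split_ifs <;> rfl
@[simp] theorem esu_search : (M.esu P d x).search = M.search := by
  unfold esu; cases d <;> dsimp only <;> split_ifs <;> rfl

@[simp] theorem tune_comp : (M.tune d x).comp = M.comp := by unfold tune; split_ifs <;> rfl
@[simp] theorem tune_search : (M.tune d x).search = M.search := by unfold tune; split_ifs <;> rfl
@[simp] theorem tune_fbar1 : (M.tune d x).fbar1 = M.fbar1 := by unfold tune; split_ifs <;> rfl
@[simp] theorem tune_fsol2 : (M.tune d x).fsol2 = M.fsol2 := by unfold tune; split_ifs <;> rfl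
@[simp] theorem tune_sol : (M.tune d x).sol = M.sol := by unfold tune; split_ifs <;> rfl

@[simp] theorem tune_h_pri : (M.tune d x).h d' d'.pri = M.h d' d'.pri := by
  unfold tune
  split_ifs
  · rcases d.eq_or_eq_opp d' with rfl | rfl <;> simp
  · rfl

@[simp] theorem tune_ub_sec : (M.tune d x).ub d' d'.sec = M.ub d' d'.sec := by
  unfold tune
  split_ifs
  · rcases d.eq_or_eq_opp d' with rfl | rfl <;> simp
  · rfl

@[simp] theorem tune_primary : (M.tune d x).primary = M.primary := by
  funext d' u i
  rcases d'.eq_pri_or_eq_sec i with rfl | rfl <;> simp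

theorem tune_secondary (M : Main S) (d : Dir) (x : Node S) (d' : Dir) (u : S) :
    (M.tune d x).secondary d' u = M.secondary d' u ∨
    d' = d.opp ∧ u = x.state ∧ (M.search d).gmin u = ⊤ ∧
      ∀ i, (M.tune d x).secondary d' u i = x.g i := by
  unfold tune
  split_ifs with hg
  · by_cases h : d' = d.opp ∧ u = x.state
    · obtain ⟨rfl, rfl⟩ := h
      refine Or.inr ⟨rfl, rfl, hg, fun i => ?_⟩
      rcases d.eq_pri_or_eq_sec i with rfl | rfl <;> simp [secondary]
    · refine Or.inl (funext fun i => ?_)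
      have hne : ∀ j, ¬ (d' = d.opp ∧ i = j ∧ u = x.state) := fun j hj => h ⟨hj.1, hj.2.2⟩
      simp [secondary, hne]
  · exact Or.inl rfl

theorem Sound.tune (h : Sound P M) (hx : P.Reach d Set.univ x.state x.g) :
    Sound P (M.tune d x) where
  node d' y hy := by
    rw [tune_search] at hy
    exact ⟨(h.node d' y hy).trail, by simpa using (h.node d' y hy).f_pri⟩
  primary := by simpa using h.primary
  secondary d' u i hi := by
    rcases tune_secondary M d x d' u with hs | ⟨rfl, rfl, -, hs⟩
    · rw [hs] at hi ⊢
      exact h.secondary d' u i hi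
    · exact ⟨x.g, by simpa using hx, hs⟩
  attained := by simpa using h.attained
  sol := by simpa [toOutput] using h.sol
  exists_feasible := by simpa using h.exists_feasible

theorem Sound.with_search (h : Sound P M) (s : Dir → Search S)
    (hn : ∀ d, ∀ x ∈ (s d).opn, ValidNode P M.h d x) : Sound P { M with search := s } :=
  ⟨hn, h.primary, h.secondary, h.attained, h.sol, h.exists_feasible⟩

theorem mem_opn_of_mem_opn_pop (hy : y ∈ ((M.pop d x).search d').opn) :
    y ∈ (M.search d').opn := by
  classical
  rcases d.eq_or_eq_opp d' with rfl | rfl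
  · simp only [pop, if_true] at hy
    exact Multiset.mem_of_mem_erase hy
  · simpa [pop] using hy

theorem eq_or_mem_opn_pop (hy : y ∈ (M.search d).opn) :
    y = x ∨ y ∈ ((M.pop d x).search d).opn := by
  classical
  simp only [pop, if_true]
  exact or_iff_not_imp_left.2 fun h => (Multiset.mem_erase_of_ne h).2 hy

@[simp] theorem pop_gmin : ((M.pop d x).search d').gmin = (M.search d').gmin := by
  rcases d.eq_or_eq_opp d' with rfl | rfl <;> simp [pop]

theorem pop_search_opp : (M.pop d x).search d.opp = M.search d.opp := by simp [pop]

@[simp] theorem setGmin_opn : ((M.setGmin d x).search d').opn = (M.search d').opn := by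
  rcases d.eq_or_eq_opp d' with rfl | rfl <;> simp [setGmin]

theorem Sound.pop (h : Sound P M) (d : Dir) (x : Node S) : Sound P (M.pop d x) :=
  h.with_search _ fun d' y hy => h.node d' y (mem_opn_of_mem_opn_pop hy)

theorem Sound.setGmin (h : Sound P M) (d : Dir) (x : Node S) : Sound P (M.setGmin d x) :=
  h.with_search _ fun d' y hy => h.node d' y (by rwa [← setGmin_opn])

/-- The state in the exploration of the extracted node `x` once the bounds, `g_min` and the
solution have been updated, before `x` is expanded. -/
def settle (P : Instance S) (M : Main S) (d : Dir) (x : Node S) : Main S :=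
  (((M.pop d x).tune d x).setGmin d x).esu P d x

theorem settle_h : (M.settle P d x).h = ((M.pop d x).tune d x).h := esu_h

theorem settle_ub : (M.settle P d x).ub = ((M.pop d x).tune d x).ub := esu_ub

theorem settle_h_pri : (M.settle P d x).h d' d'.pri = M.h d' d'.pri := by
  rw [settle_h, tune_h_pri]; rfl

theorem settle_ub_sec : (M.settle P d x).ub d' d'.sec = M.ub d' d'.sec := by
  rw [settle_ub, tune_ub_sec]; rfl

theorem settle_search_opp : (M.settle P d x).search d.opp = M.search d.opp := by
  simp [settle, setGmin, pop]

theorem settle_opn : ((M.settle P d x).search d').opn = ((M.pop d x).search d').opn := by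
  simp [settle]

open scoped Classical in
theorem settle_gmin (v : S) : ((M.settle P d x).search d).gmin v =
    if v = x.state then (x.g d.sec : ℝ≥0∞) else (M.search d).gmin v := by
  simp [settle, setGmin]

theorem Sound.of_pop_tune_setGmin (h : Sound P M) (hx : P.Reach d Set.univ x.state x.g) :
    Sound P (((M.pop d x).tune d x).setGmin d x) :=
  ((h.pop d x).tune hx).setGmin d x

theorem estimate_le_fbar_pop_tune_setGmin
    (hf : (x.g d.pri : ℝ≥0∞) + M.h d d.pri x.state ≤ M.fbar P d.pri) :
    (x.g d.pri : ℝ≥0∞) + (((M.pop d x).tune d x).setGmin d x).h d d.pri x.state ≤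
      (((M.pop d x).tune d x).setGmin d x).fbar P d.pri := by
  simpa [fbar, setGmin, pop] using hf

theorem Sound.settle (h : Sound P M) (hx : P.Trail d Set.univ x.state (x.state :: x.anc) x.g)
    (hf : (x.g d.pri : ℝ≥0∞) + M.h d d.pri x.state ≤ M.fbar P d.pri) :
    Sound P (M.settle P d x) :=
  (h.of_pop_tune_setGmin hx.reach).esu hx (estimate_le_fbar_pop_tune_setGmin hf)

theorem Solved.settle (hs : Solved C M) (hC : P.IsOptimalCost C) (h : Sound P M)
    (hx : P.Trail d Set.univ x.state (x.state :: x.anc) x.g)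
    (hf : (x.g d.pri : ℝ≥0∞) + M.h d d.pri x.state ≤ M.fbar P d.pri) :
    Solved C (M.settle P d x) := by
  refine Solved.esu ?_ hC (h.of_pop_tune_setGmin hx.reach) hx
    (estimate_le_fbar_pop_tune_setGmin hf)
  simpa [Solved, Main.setGmin, Main.pop] using hs

theorem solved_settle (hC : P.IsOptimalCost C) (h : Sound P M)
    (hx : P.Trail d Set.univ x.state (x.state :: x.anc) x.g)
    (hf : (x.g d.pri : ℝ≥0∞) + M.h d d.pri x.state ≤ M.fbar P d.pri)
    (hle : ∀ i, M.primaryJoin d x i ≤ C i) : Solved C (M.settle P d x) := by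
  refine solved_esu hC (h.of_pop_tune_setGmin hx.reach) hx
    (estimate_le_fbar_pop_tune_setGmin hf) ?_
  change ∀ i, (x.g i : ℝ≥0∞) + ((M.pop d x).tune d x).primary d x.state i ≤ C i
  rw [tune_primary]
  exact hle

section Explore

variable [Fintype S]

theorem explore_eq : (M.pop d x).explore P d x =
    if (M.settle P d x).h d d.pri x.state = (M.settle P d x).ub d d.pri x.state
    then M.settle P d x else (M.settle P d x).exp P d x := rfl

theorem mem_opn_exp : y ∈ ((M.exp P d x).search d').opn ↔ y ∈ (M.search d').opn ∨
    d' = d ∧ ∃ v, (P.arc d x.state v ∧ Keep P M d (child P M d x v)) ∧ child P M d x v = y := by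
  rcases d.eq_or_eq_opp d' with rfl | rfl <;> simp [exp]

theorem exp_search_opp : (M.exp P d x).search d.opp = M.search d.opp := by
  simp [exp]

@[simp] theorem exp_gmin : ((M.exp P d x).search d').gmin = (M.search d').gmin := by
  rcases d.eq_or_eq_opp d' with rfl | rfl <;> simp [exp]

theorem Sound.exp (h : Sound P M) (hx : P.Trail d Set.univ x.state (x.state :: x.anc) x.g) :
    Sound P (M.exp P d x) := by
  refine h.with_search _ fun d' y hy => ?_
  rcases mem_opn_exp.1 hy with hy | ⟨rfl, v, ⟨ha, -⟩, rfl⟩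
  · exact h.node d' y hy
  · exact ⟨hx.step ha (Set.mem_univ _), rfl⟩

theorem explore_search_opp : ((M.pop d x).explore P d x).search d.opp = M.search d.opp := by
  rw [explore_eq]
  split_ifs
  · exact settle_search_opp
  · rw [exp_search_opp, settle_search_opp]

open scoped Classical in
theorem explore_gmin (v : S) : (((M.pop d x).explore P d x).search d).gmin v =
    if v = x.state then (x.g d.sec : ℝ≥0∞) else (M.search d).gmin v := by
  rw [explore_eq, ← settle_gmin (P := P)]
  split_ifs
  exacts [rfl, congrFun exp_gmin v]

theorem Sound.explore (h : Sound P M) (hx : P.Trail d Set.univ x.state (x.state :: x.anc) x.g)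
    (hf : (x.g d.pri : ℝ≥0∞) + M.h d d.pri x.state ≤ M.fbar P d.pri) :
    Sound P ((M.pop d x).explore P d x) := by
  rw [explore_eq]
  split_ifs
  exacts [h.settle hx hf, (h.settle hx hf).exp hx]

theorem Sound.iterate (h : Sound P M) (hx : M.IsLeast d x) (hf : x.f d.pri ≤ M.fbar P d.pri) :
    Sound P (M.iterate P d x) := by
  have hn := h.node d x hx.1
  rw [hn.f_pri] at hf
  simp only [Main.iterate]
  split_ifs
  exacts [h.pop d x, h.pop d x, h.explore hn.trail hf]

end Explore

/-! ### Optimality of the constrained search -/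

/-- A node for the part of cost `a` ending in `u` is open, and its secondary estimate does not
exceed the optimal cost. -/
def Opened (C : Fin 2 → ℝ≥0) (d : Dir) (s : Search S) (u : S) (a : Fin 2 → ℝ≥0) : Prop :=
  ∃ y ∈ s.opn, y.state = u ∧ y.g = a ∧ y.f d.sec ≤ C d.sec

/-- The part of cost `a` ending in `u` is weakly dominated by a node expanded in `u`. -/
def Covered (d : Dir) (s : Search S) (u : S) (a : Fin 2 → ℝ≥0) : Prop := s.gmin u ≤ a d.sec

/-- The part of cost `a` ending in `u` waits for expansion, or needs none. -/
def Handled (C : Fin 2 → ℝ≥0) (d : Dir) (s : Search S) (u : S) (a : Fin 2 → ℝ≥0) : Prop :=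
  Opened C d s u a ∨ Covered d s u a

variable (P C d) in
/-- Along an optimal path, the part after a covered part is open or covered, and the search has not
yet covered a complete optimal path. -/
structure Progress (s : Search S) : Prop where
  root : Handled C d s (P.initial d) 0
  step : ∀ u v a b, P.Reach d Set.univ u a → P.arc d u v →
    P.Split C d v (a + P.arcCost d u v) b → Covered d s u a →
    Handled C d s v (a + P.arcCost d u v)
  target : ¬ Covered d s (P.target d) C

variable (P C) in
/-- On optimal paths, the primary lower bounds are valid and consistent, and the companion upper
bounds belong to lexicographically smallest complementary paths. -/
structure Exact (M : Main S) : Prop where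
  le : ∀ d u a b, P.Split C d u a b → M.h d d.pri u ≤ b d.pri
  ub_le : ∀ d u a b, P.Split C d u a b → M.h d d.pri u = b d.pri → M.ub d d.sec u ≤ b d.sec
  consistent : ∀ d u v a b a' b', P.Split C d u a b → P.Split C d v a' b' → P.arc d u v →
    M.h d d.pri u ≤ (P.arcCost d u v d.pri : ℝ≥0∞) + M.h d d.pri v

variable (P C) in
/-- On optimal paths, the secondary lower bounds are valid. -/
def Valid (M : Main S) : Prop := ∀ d u a b, P.Split C d u a b → M.h d d.sec u ≤ b d.sec

variable (P C) in
/-- The optimality invariant: until an optimal path has been found, both searches make progress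
towards one. -/
structure Optimizing (M : Main S) : Prop where
  exact : Exact P C M
  live : Solved C M ∨ (Valid P C M ∧ ∀ d, Progress P C d (M.search d))

theorem Exact.congr {M' : Main S} (he : Exact P C M) (hh : ∀ d, M'.h d d.pri = M.h d d.pri)
    (hu : ∀ d, M'.ub d d.sec = M.ub d d.sec) : Exact P C M' := by
  constructor
  · simpa only [hh] using he.le
  · simpa only [hh, hu] using he.ub_le
  · simpa only [hh] using he.consistent

theorem Exact.primary_le (he : Exact P C M) (hs : P.Split C d u a b)
    (heq : M.h d d.pri u = b d.pri) (i : Fin 2) : M.primary d u i ≤ b i := by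
  rcases d.eq_pri_or_eq_sec i with rfl | rfl
  · simpa using heq.le
  · simpa using he.ub_le d u a b hs heq

theorem Sound.primary_eq_of_le (h : Sound P M) (hC : P.IsOptimalCost C) (hs : P.Split C d u a b)
    (hle : ∀ i, M.primary d u i ≤ b i) (i : Fin 2) : M.primary d u i = b i := by
  obtain ⟨c, hc, hj⟩ := h.primary d u i (ne_top_of_le_ne_top ENNReal.coe_ne_top (hle i))
  simp only [hj, ENNReal.coe_le_coe] at hle
  rw [hj, hC.eq_right hs hc.reach hle]

theorem Sound.secondary_eq_of_le (h : Sound P M) (hC : P.IsOptimalCost C)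
    (hs : P.Split C d u a b) (hle : ∀ i, M.secondary d u i ≤ b i) (i : Fin 2) :
    M.secondary d u i = b i := by
  obtain ⟨c, hc, hj⟩ := h.secondary d u i (ne_top_of_le_ne_top ENNReal.coe_ne_top (hle i))
  simp only [hj, ENNReal.coe_le_coe] at hle
  rw [hj, hC.eq_right hs hc hle]

theorem Valid.h_le (hv : Valid P C M) (he : Exact P C M) (hs : P.Split C d u a b) (i : Fin 2) :
    M.h d i u ≤ b i := by
  rcases d.eq_pri_or_eq_sec i with rfl | rfl
  exacts [he.le d u a b hs, hv d u a b hs]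

theorem Valid.secondary_eq (hv : Valid P C M) (h : Sound P M) (hC : P.IsOptimalCost C)
    (hs : P.Split C d u a b) (hle : M.ub d d.pri u ≤ b d.pri) (i : Fin 2) :
    M.secondary d u i = b i := by
  refine h.secondary_eq_of_le hC hs (fun j => ?_) i
  rcases d.eq_pri_or_eq_sec j with rfl | rfl
  · simpa using hle
  · simpa using hv d u a b hs

theorem Exact.primary_eq (he : Exact P C M) (h : Sound P M) (hC : P.IsOptimalCost C)
    (hs : P.Split C d u a b) (hle : M.ub d d.sec u ≤ b d.sec) (i : Fin 2) :
    M.primary d u i = b i := by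
  refine h.primary_eq_of_le hC hs (fun j => ?_) i
  rcases d.eq_pri_or_eq_sec j with rfl | rfl
  · simpa using he.le d u a b hs
  · simpa using hle

theorem Valid.le_ub (hv : Valid P C M) (he : Exact P C M) (h : Sound P M)
    (hC : P.IsOptimalCost C) (hs : P.Split C d u a b) (i : Fin 2) :
    (b i : ℝ≥0∞) ≤ M.ub d i u := by
  rcases d.eq_pri_or_eq_sec i with rfl | rfl
  · rcases le_total (b d.pri : ℝ≥0∞) (M.ub d d.pri u) with hle | hle
    · exact hle
    · simpa using (hv.secondary_eq h hC hs hle d.pri).ge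
  · rcases le_total (b d.sec : ℝ≥0∞) (M.ub d d.sec u) with hle | hle
    · exact hle
    · simpa using (he.primary_eq h hC hs hle d.sec).ge

/-- This justifies that states with equal primary bounds are not expanded. -/
theorem Valid.primary_le_of_h_eq_ub (hv : Valid P C M) (he : Exact P C M) (h : Sound P M)
    (hC : P.IsOptimalCost C) (hs : P.Split C d u a b) (heq : M.h d d.pri u = M.ub d d.pri u)
    (i : Fin 2) : M.primary d u i ≤ b i := by
  have hub := hv.secondary_eq h hC hs (heq ▸ he.le d u a b hs) d.pri
  rw [secondary_pri, ← heq] at hub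
  exact he.primary_le hs hub i

theorem Progress.covered_or_open (hp : Progress P C d (M.search d)) (h : Sound P M)
    (he : Exact P C M) (hs : P.Split C d u a b) :
    Covered d (M.search d) u a ∨ ∃ y ∈ (M.search d).opn,
      y.f d.pri ≤ (a d.pri : ℝ≥0∞) + M.h d d.pri u := by
  have hopen : ∀ v c, Opened C d (M.search d) v c → ∃ y ∈ (M.search d).opn,
      y.f d.pri ≤ (c d.pri : ℝ≥0∞) + M.h d d.pri v := by
    rintro v c ⟨y, hy, rfl, rfl, -⟩
    exact ⟨y, hy, (h.node d y hy).f_pri.le⟩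
  obtain ⟨l, t⟩ := hs.left
  induction t generalizing b with
  | root _ => exact hp.root.symm.imp_right (hopen _ _)
  | @step u v l c t ha _ ih =>
    have hprev := hs.prev t.reach ha
    rcases ih hprev with hc | ⟨y, hy, hf⟩
    · exact (hp.step u v c b t.reach ha hs hc).symm.imp_right (hopen _ _)
    · refine Or.inr ⟨y, hy, hf.trans ?_⟩
      calc (c d.pri : ℝ≥0∞) + M.h d d.pri u
          ≤ c d.pri + (P.arcCost d u v d.pri + M.h d d.pri v) := by
            gcongr; exact he.consistent d u v _ _ _ _ hprev hs ha
        _ = _ := by simp [add_assoc]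

theorem Sound.coe_le_fbar (h : Sound P M) (hC : P.IsOptimalCost C) (i : Fin 2) :
    (C i : ℝ≥0∞) ≤ M.fbar P i := by
  fin_cases i
  exacts [hC.le_of_isAttained h.attained, ENNReal.coe_le_coe.2 hC.feasible.2]

theorem Progress.exists_open (hp : Progress P C d (M.search d)) (h : Sound P M)
    (he : Exact P C M) (hC : P.IsOptimalCost C) :
    ∃ y ∈ (M.search d).opn, y.f d.pri ≤ M.fbar P d.pri := by
  have hs := hC.split_target d
  obtain ⟨y, hy, hf⟩ := (hp.covered_or_open h he hs).resolve_left hp.target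
  refine ⟨y, hy, hf.trans ?_⟩
  have hzero : M.h d d.pri (P.target d) = 0 := by simpa using he.le d _ _ _ hs
  simpa [hzero] using h.coe_le_fbar hC d.pri

theorem Progress.g_pri_le (hp : Progress P C d (M.search d)) (h : Sound P M)
    (he : Exact P C M) (hx : M.IsLeast d x) (hs : P.Split C d x.state a b)
    (hc : ¬ Covered d (M.search d) x.state a) : x.g d.pri ≤ a d.pri := by
  obtain ⟨y, hy, hf⟩ := (hp.covered_or_open h he hs).resolve_left hc
  have hle : x.f d.pri ≤ y.f d.pri := Prod.Lex.monotone_fst _ _ (hx.2 y hy)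
  rw [(h.node d x hx.1).f_pri] at hle
  have hne : M.h d d.pri x.state ≠ ⊤ :=
    ne_top_of_le_ne_top ENNReal.coe_ne_top (he.le d _ _ _ hs)
  exact_mod_cast (ENNReal.add_le_add_iff_right hne).1 (hle.trans hf)

theorem Handled.mono {s s' : Search S} (hu : Handled C d s u a)
    (hg : ∀ v, s'.gmin v ≤ s.gmin v)
    (ho : ∀ y ∈ s.opn, y.f d.sec ≤ C d.sec → y ∈ s'.opn ∨ Covered d s' y.state y.g) :
    Handled C d s' u a := by
  rcases hu with ⟨y, hy, rfl, rfl, hf⟩ | hc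
  · exact (ho y hy hf).imp_left fun h => ⟨y, h, rfl, rfl, hf⟩
  · exact Or.inr ((hg u).trans hc)

theorem covered_pop : Covered d ((M.pop d x).search d) u a ↔ Covered d (M.search d) u a := by
  simp [Covered]

theorem Progress.pop (hp : Progress P C d (M.search d))
    (hx : x.f d.sec ≤ C d.sec → Covered d (M.search d) x.state x.g) :
    Progress P C d ((M.pop d x).search d) := by
  have hmono : ∀ {u a}, Handled C d (M.search d) u a → Handled C d ((M.pop d x).search d) u a := by
    intro u a hu
    refine hu.mono (by simp) fun y hy hf => ?_
    rcases eq_or_mem_opn_pop (x := x) hy with rfl | hy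
    exacts [Or.inr (covered_pop.2 (hx hf)), Or.inl hy]
  exact ⟨hmono hp.root,
    fun u v a b hu ha hs hc => hmono (hp.step u v a b hu ha hs (covered_pop.1 hc)),
    fun hc => hp.target (covered_pop.1 hc)⟩

theorem Optimizing.pop (h : Optimizing P C M)
    (hx : x.f d.sec ≤ C d.sec → Covered d (M.search d) x.state x.g) :
    Optimizing P C (M.pop d x) := by
  refine ⟨h.exact.congr (fun _ => rfl) (fun _ => rfl), h.live.imp id fun ⟨hv, hp⟩ => ⟨hv, ?_⟩⟩
  intro d'
  rcases d.eq_or_eq_opp d' with rfl | rfl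
  · exact (hp d').pop hx
  · rw [pop_search_opp]
    exact hp d.opp

theorem Exact.settle (he : Exact P C M) : Exact P C (M.settle P d x) :=
  he.congr (fun _ => settle_h_pri) (fun _ => settle_ub_sec)

/-- Tuning preserves validity because the first node expanded in a state is the cheapest one in
the primary attribute. -/
theorem Valid.settle (hv : Valid P C M) (hp : Progress P C d (M.search d)) (h : Sound P M)
    (he : Exact P C M) (hx : M.IsLeast d x) : Valid P C (M.settle P d x) := by
  intro d' u a b hs
  rw [settle_h, ← secondary_sec]
  rcases tune_secondary (M.pop d x) d x d' u with ht | ⟨rfl, rfl, hg, ht⟩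
  · rw [ht, secondary_sec]
    exact hv d' u a b hs
  · rw [pop_gmin] at hg
    have hs' : P.Split C d x.state b a := by simpa using hs.symm
    simpa [ht] using hp.g_pri_le h he hx hs' (by simp [Covered, hg])

theorem settle_primary : (M.settle P d x).primary = M.primary := by
  funext d' u i
  rcases d'.eq_pri_or_eq_sec i with rfl | rfl
  · rw [primary_pri, primary_pri, settle_h_pri]
  · rw [primary_sec, primary_sec, settle_ub_sec]

theorem solved_settle_of_split (hC : P.IsOptimalCost C) (h : Sound P M)
    (hx : P.Trail d Set.univ x.state (x.state :: x.anc) x.g)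
    (hf : (x.g d.pri : ℝ≥0∞) + M.h d d.pri x.state ≤ M.fbar P d.pri)
    (hs : P.Split C d x.state x.g b) (hle : ∀ i, M.primary d x.state i ≤ b i) :
    Solved C (M.settle P d x) := by
  refine solved_settle hC h hx hf fun i => ?_
  rw [← hs.sum, Pi.add_apply, ENNReal.coe_add]
  exact add_le_add_right (hle i) _

section Explore

variable [Fintype S]

theorem handled_exp_child (h : Sound P M) (he : Exact P C M) (hv : Valid P C M)
    (hC : P.IsOptimalCost C) (ha : P.arc d x.state v)
    (hs : P.Split C d v (x.g + P.arcCost d x.state v) b) :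
    Handled C d ((M.exp P d x).search d) v (x.g + P.arcCost d x.state v) := by
  rcases lt_or_ge ((x.g + P.arcCost d x.state v) d.sec : ℝ≥0∞) ((M.search d).gmin v)
    with hg | hg
  · have hle : ∀ i, (child P M d x v).f i ≤ C i := fun i =>
      calc (child P M d x v).f i
          ≤ ((x.g + P.arcCost d x.state v) i : ℝ≥0) + (b i : ℝ≥0∞) :=
            add_le_add_right (hv.h_le he hs i) _
        _ = C i := by rw [← hs.sum, ← ENNReal.coe_add, Pi.add_apply _ b]
    have hkeep : Keep P M d (child P M d x v) :=
      ⟨hg, hv.le_ub he h hC hs.symm, fun i => (hle i).trans (h.coe_le_fbar hC i)⟩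
    exact Or.inl ⟨_, mem_opn_exp.2 (Or.inr ⟨rfl, v, ⟨ha, hkeep⟩, rfl⟩), rfl, rfl, hle _⟩
  · exact Or.inr (by simpa [Covered] using hg)

theorem Progress.eq_of_covered_explore (hp : Progress P C d (M.search d)) (h : Sound P M)
    (he : Exact P C M) (hC : P.IsOptimalCost C) (hx : M.IsLeast d x) (hs : P.Split C d u a b)
    (hc : Covered d (((M.pop d x).explore P d x).search d) u a)
    (hc' : ¬ Covered d (M.search d) u a) : u = x.state ∧ a = x.g := by
  unfold Covered at hc
  rw [explore_gmin] at hc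
  split_ifs at hc with hu
  · subst hu
    refine ⟨rfl, (hC.eq_left hs (h.node d x hx.1).trail.reach fun i => ?_).symm⟩
    rcases d.eq_pri_or_eq_sec i with rfl | rfl
    exacts [hp.g_pri_le h he hx hs hc', ENNReal.coe_le_coe.1 hc]
  · exact absurd hc hc'

theorem Handled.explore (hu : Handled C d (M.search d) u a)
    (hg : (x.g d.sec : ℝ≥0∞) < (M.search d).gmin x.state) :
    Handled C d (((M.pop d x).explore P d x).search d) u a := by
  refine hu.mono (fun v => ?_) fun y hy _ => ?_
  · rw [explore_gmin]
    split_ifs with hv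
    exacts [hv ▸ hg.le, le_rfl]
  · rcases eq_or_mem_opn_pop (x := x) hy with rfl | hy
    · exact Or.inr (by rw [Covered, explore_gmin, if_pos rfl])
    · left
      rw [← settle_opn (P := P)] at hy
      rw [explore_eq]
      split_ifs
      exacts [hy, mem_opn_exp.2 (Or.inl hy)]

/-- A part that becomes covered ends in `x`. If it is not continued, then because the complementary
primary path of `x` completes it to an optimal path, which has just been recorded. -/
theorem Progress.explore (hp : Progress P C d (M.search d)) (h : Sound P M) (he : Exact P C M)
    (hv : Valid P C M) (hC : P.IsOptimalCost C) (hx : M.IsLeast d x)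
    (hf : x.f d.pri ≤ M.fbar P d.pri) (hg : (x.g d.sec : ℝ≥0∞) < (M.search d).gmin x.state)
    (hsol : ¬ Solved C (M.settle P d x)) :
    Progress P C d (((M.pop d x).explore P d x).search d) := by
  obtain ⟨ht, hfx⟩ := h.node d x hx.1
  rw [hfx] at hf
  refine ⟨hp.root.explore hg, fun u v a b hu ha hs hc => ?_, fun hc => ?_⟩
  · by_cases hc' : Covered d (M.search d) u a
    · exact (hp.step u v a b hu ha hs hc').explore hg
    have hs' := hs.prev hu ha
    obtain ⟨rfl, rfl⟩ := hp.eq_of_covered_explore h he hC hx hs' hc hc'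
    have hsound := h.settle ht hf
    have hvalid := hv.settle hp h he hx
    rw [explore_eq]
    split_ifs with heq
    · have hle := hvalid.primary_le_of_h_eq_ub he.settle hsound hC hs' heq
      rw [settle_primary] at hle
      exact absurd (solved_settle_of_split hC h ht hf hs' hle) hsol
    · exact handled_exp_child hsound he.settle hvalid hC ha hs
  · obtain ⟨hu, ha⟩ := hp.eq_of_covered_explore h he hC hx (hC.split_target d) hc hp.target
    have hs : P.Split C d x.state x.g 0 := by
      rw [← hu, ← ha]
      exact hC.split_target d
    have hzero : M.h d d.pri x.state = (0 : Fin 2 → ℝ≥0) d.pri := by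
      simpa using he.le d _ _ _ hs
    exact hsol (solved_settle_of_split hC h ht hf hs (he.primary_le hs hzero))

theorem Optimizing.explore (h : Optimizing P C M) (hC : P.IsOptimalCost C) (hM : Sound P M)
    (hx : M.IsLeast d x) (hf : x.f d.pri ≤ M.fbar P d.pri)
    (hg : (x.g d.sec : ℝ≥0∞) < (M.search d).gmin x.state) :
    Optimizing P C ((M.pop d x).explore P d x) := by
  obtain ⟨ht, hfx⟩ := hM.node d x hx.1
  have lift : ∀ p : Main S → Prop, (∀ N s, p N → p { N with search := s }) →
      p (M.settle P d x) → p ((M.pop d x).explore P d x) := by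
    intro p hp hs
    rw [explore_eq]
    split_ifs
    exacts [hs, hp _ _ hs]
  refine ⟨lift _ (fun _ _ hN => hN.congr (fun _ => rfl) (fun _ => rfl)) h.exact.settle, ?_⟩
  by_cases hsol : Solved C (M.settle P d x)
  · exact Or.inl (lift _ (fun _ _ => id) hsol)
  rcases h.live with hs | ⟨hv, hp⟩
  · exact absurd (hs.settle hC hM ht (hfx ▸ hf)) hsol
  refine Or.inr ⟨lift _ (fun _ _ => id) (hv.settle (hp d) hM h.exact hx), fun d' => ?_⟩
  rcases d.eq_or_eq_opp d' with rfl | rfl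
  · exact (hp d').explore hM h.exact hv hC hx hf hg hsol
  · rw [explore_search_opp]
    exact hp d.opp

theorem Optimizing.iterate (h : Optimizing P C M) (hC : P.IsOptimalCost C) (hM : Sound P M)
    (hx : M.IsLeast d x) (hf : x.f d.pri ≤ M.fbar P d.pri) :
    Optimizing P C (M.iterate P d x) := by
  simp only [Main.iterate, pop_gmin]
  split_ifs with hbound hdom
  · exact h.pop fun hle => absurd (hle.trans (hM.coe_le_fbar hC d.sec)) hbound.2.not_ge
  · exact h.pop fun _ => hdom
  · exact h.explore hC hM hx hf (not_le.1 hdom)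

end Explore

end Main

/-! ### Optimal paths in the initialisation -/

section Initialisation

variable {S : Type*} {P : Instance S} {e₁ e₂ : S → ℝ≥0} {C a b : Fin 2 → ℝ≥0} {d : Dir}
  {p : Fin 2} {A B : Set S} {e : S → ℝ≥0} {u : S} {l : Label S} {r : Round1 S} {R : Round2 S}
  {s : HSearch S} {x : ℝ≥0∞}

theorem Instance.IsHeuristic.consistentOn (he : P.IsHeuristic d p e) :
    HSearch.ConsistentOn P d p Set.univ (fun v => (e v : ℝ≥0∞)) :=
  ⟨fun _ _ => ENNReal.coe_ne_top, fun u _ v _ h => by exact_mod_cast he.consistent u v h⟩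

theorem Instance.IsHeuristic.le (he : P.IsHeuristic d p e) (h : P.Reach d.opp Set.univ u b) :
    e u ≤ b p := by
  obtain ⟨l, t⟩ := h
  obtain ⟨hl, rfl⟩ := t.isPath
  exact he.admissible u l hl

theorem Instance.Split.coe_add_le (h : P.Split C d u a b) {i : Fin 2} (hx : x ≤ a i) :
    (b i : ℝ≥0∞) + x ≤ C i := by
  calc (b i : ℝ≥0∞) + x ≤ b i + a i := by gcongr
    _ = C i := by rw [← h.sum, Pi.add_apply, ENNReal.coe_add, add_comm]

theorem Instance.Split.reach_of_mem (hA : ∀ u a b, P.Split C d u a b → u ∈ A)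
    (hs : P.Split C d u a b) : P.Reach d A u a := by
  obtain ⟨l, t⟩ := hs.left
  induction t generalizing b with
  | root _ => exact .root (hA _ _ _ hs)
  | step t ha _ ih => exact (ih (hs.prev t.reach ha)).step ha (hA _ _ _ hs)

theorem Round2.matching_le : Round2.matching P s u l x ≤ x := by
  unfold matching
  split_ifs
  exacts [min_le_left _ _, le_rfl]

theorem Round2.isAttained_matching (hs : HSearch.Inv P d.opp p A s)
    (hl : P.Trail d B u l.path l.cost) (hx : P.IsAttained x) :
    P.IsAttained (Round2.matching P s u l x) := by
  unfold matching
  split_ifs with hW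
  · have hne : s.value 1 u ≠ ⊤ := fun h => by simp [h] at hW
    obtain ⟨b, hb, hv, -⟩ := hs.exists_value_eq (HSearch.mem_closed_of_value_ne_top hne)
    rw [hv] at hW ⊢
    rcases min_choice x ((l.cost 0 : ℝ≥0∞) + b 0) with h | h
    · rwa [h]
    · rw [h]
      exact Or.inr ⟨l.cost + b, ⟨hl.reach.univ.join hb.reach.univ, by exact_mod_cast hW⟩,
        by simp⟩
  · exact hx

variable (P e₁ e₂) in
/-- The invariant of round one. -/
structure Round1.Inv (r : Round1 S) : Prop where
  back2 : HSearch.Inv P .bwd 1 Set.univ r.back2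
  fwd1 : HSearch.Inv P .fwd 0 Set.univ r.fwd1
  back2_complete : HSearch.Complete P .bwd 1 Set.univ (fun v => (e₂ v : ℝ≥0∞)) P.W r.back2
  fwd1_complete : HSearch.Complete P .fwd 0 Set.univ (fun v => (e₁ v : ℝ≥0∞)) r.fbar1 r.fwd1
  attained : P.IsAttained r.fbar1
  start : P.start ∉ r.back2.closed → r.fbar1 = ⊤

variable (P) in
/-- The invariant of round two. -/
structure Round2.Inv (R : Round2 S) : Prop where
  back2 : HSearch.Inv P .bwd 1 Set.univ R.r.back2
  fwd1 : HSearch.Inv P .fwd 0 Set.univ R.r.fwd1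
  attained : P.IsAttained R.r.fbar1
  mem_allowed : ∀ C, P.IsOptimalCost C → ∀ d u a b, P.Split C d u a b → u ∈ Round2.allowed R.r
  fwd2 : HSearch.Inv P .fwd 1 (Round2.allowed R.r) R.fwd2
  back1 : HSearch.Inv P .bwd 0 (Round2.allowed R.r) R.back1
  fwd2_complete : HSearch.Complete P .fwd 1 (Round2.allowed R.r) (R.r.back2.value 1) P.W R.fwd2
  back1_complete : HSearch.Complete P .bwd 0 (Round2.allowed R.r) (R.r.fwd1.value 0) R.r.fbar1
    R.back1

namespace Round1

theorem Inv.init : Round1.Inv P e₁ e₂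
    ⟨HSearch.init P.goal Set.univ, HSearch.init P.start Set.univ, ⊤⟩ :=
  ⟨HSearch.init_inv (d := .bwd), HSearch.init_inv (d := .fwd),
    HSearch.complete_of_not_finished id, HSearch.complete_of_not_finished id, Or.inl rfl,
    fun _ => rfl⟩

open scoped Classical in
theorem Inv.back2_expand (h : r.Inv P e₁ e₂) (he₂ : P.IsHeuristic .bwd 1 e₂)
    (hu : r.back2.CanExpand 1 (fun v => (e₂ v : ℝ≥0∞)) P.W u l) :
    Round1.Inv P e₁ e₂ { r with
      back2 := r.back2.expand P .bwd 1 Set.univ u l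
      fbar1 := if u = P.start then (l.cost 0 : ℝ≥0∞) else r.fbar1 } where
  back2 := h.back2.expand he₂.consistentOn hu.2.1
  fwd1 := h.fwd1
  back2_complete := HSearch.complete_of_not_finished hu.1
  fwd1_complete := by
    refine h.fwd1_complete.mono ?_
    split_ifs with hs
    · rw [h.start (hs ▸ hu.2.1.1.2)]
      exact le_top
    · exact le_rfl
  attained := by
    split_ifs with hs
    · subst hs
      refine Or.inr ⟨l.cost, ⟨(h.back2.trail _ l hu.2.1.1.1).reach, ?_⟩, rfl⟩
      exact_mod_cast le_self_add.trans hu.2.2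
    · exact h.attained
  start hn := by
    rw [if_neg fun hs => hn (Or.inl hs.symm)]
    exact h.start fun hc => hn (Or.inr hc)

theorem Inv.mem_allowed (h : r.Inv P e₁ e₂) (he₁ : P.IsHeuristic .fwd 0 e₁)
    (he₂ : P.IsHeuristic .bwd 1 e₂) (hb : r.back2.finished) (hf : r.fwd1.finished)
    (hC : P.IsOptimalCost C) (hs : P.Split C .fwd u a b) : u ∈ Round2.allowed r := by
  constructor
  · refine h.back2_complete hb u b hs.right (le_trans ?_ (ENNReal.coe_le_coe.2 hC.feasible.2))
    exact hs.coe_add_le (ENNReal.coe_le_coe.2 (he₂.le hs.left))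
  · refine h.fwd1_complete hf u a hs.left (le_trans ?_ (hC.le_of_isAttained h.attained))
    exact hs.symm.coe_add_le (ENNReal.coe_le_coe.2 (he₁.le hs.right))

theorem Inv.to_round2 (h : r.Inv P e₁ e₂) (he₁ : P.IsHeuristic .fwd 0 e₁)
    (he₂ : P.IsHeuristic .bwd 1 e₂) (hb : r.back2.finished) (hf : r.fwd1.finished) :
    Round2.Inv P ⟨r, HSearch.init P.start (Round2.allowed r),
      HSearch.init P.goal (Round2.allowed r)⟩ where
  back2 := h.back2
  fwd1 := h.fwd1
  attained := h.attained
  mem_allowed C hC d u a b hs := by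
    cases d
    exacts [h.mem_allowed he₁ he₂ hb hf hC hs, h.mem_allowed he₁ he₂ hb hf hC hs.symm]
  fwd2 := HSearch.init_inv (d := .fwd)
  back1 := HSearch.init_inv (d := .bwd)
  fwd2_complete := HSearch.complete_of_not_finished id
  back1_complete := HSearch.complete_of_not_finished id

end Round1

namespace Round2

theorem Inv.consistentOn_back2 (h : R.Inv P) :
    HSearch.ConsistentOn P .fwd 1 (allowed R.r) (R.r.back2.value 1) :=
  HSearch.Inv.consistentOn (d := .fwd) h.back2 Set.inter_subset_left (Set.subset_univ _)

theorem Inv.consistentOn_fwd1 (h : R.Inv P) :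
    HSearch.ConsistentOn P .bwd 0 (allowed R.r) (R.r.fwd1.value 0) :=
  HSearch.Inv.consistentOn (d := .bwd) h.fwd1 Set.inter_subset_right (Set.subset_univ _)

theorem Inv.fwd2_expand (h : R.Inv P) (hu : R.fwd2.CanExpand 1 (R.r.back2.value 1) P.W u l) :
    Inv P { R with
      r := { R.r with fbar1 := matching P R.r.back2 u l R.r.fbar1 }
      fwd2 := R.fwd2.expand P .fwd 1 (allowed R.r) u l } :=
  { h with
    attained := isAttained_matching (d := .fwd) h.back2 (h.fwd2.trail u l hu.2.1.1.1) h.attained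
    fwd2 := h.fwd2.expand h.consistentOn_back2 hu.2.1
    fwd2_complete := HSearch.complete_of_not_finished hu.1
    back1_complete := h.back1_complete.mono matching_le }

theorem Inv.back1_expand (h : R.Inv P) (hu : R.back1.CanExpand 0 (R.r.fwd1.value 0) R.r.fbar1 u l) :
    Inv P { R with
      r := { R.r with fbar1 := matching P R.r.fwd1 u l R.r.fbar1 }
      back1 := R.back1.expand P .bwd 0 (allowed R.r) u l } :=
  { h with
    attained := isAttained_matching (d := .bwd) h.fwd1 (h.back1.trail u l hu.2.1.1.1) h.attained
    back1 := h.back1.expand h.consistentOn_fwd1 hu.2.1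
    back1_complete := HSearch.complete_of_not_finished hu.1 }

/-- The search of the initialisation that provides the primary bounds of a direction. -/
def primarySearch (R : Round2 S) : Dir → HSearch S
  | .fwd => R.back1
  | .bwd => R.fwd2

/-- The search of the initialisation that provides the secondary bounds of a direction. -/
def secondarySearch (R : Round2 S) : Dir → HSearch S
  | .fwd => R.r.back2
  | .bwd => R.r.fwd1

theorem Inv.primarySearch (h : R.Inv P) (d : Dir) :
    HSearch.Inv P d.opp d.pri (allowed R.r) (R.primarySearch d) := by
  cases d
  exacts [h.back1, h.fwd2]

theorem Inv.secondarySearch (h : R.Inv P) (d : Dir) :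
    HSearch.Inv P d.opp d.sec Set.univ (R.secondarySearch d) := by
  cases d
  exacts [h.back2, h.fwd1]

theorem Inv.mem_closed_secondarySearch (h : R.Inv P) (hC : P.IsOptimalCost C)
    (hs : P.Split C d u a b) : u ∈ (R.secondarySearch d).closed := by
  have hu := h.mem_allowed C hC d u a b hs
  cases d
  exacts [hu.1, hu.2]

theorem Inv.reach_allowed (h : R.Inv P) (hC : P.IsOptimalCost C) (hs : P.Split C d u a b) :
    P.Reach d.opp (allowed R.r) u b :=
  hs.symm.reach_of_mem fun u a b => h.mem_allowed C hC d.opp u a b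

theorem Inv.value_secondarySearch_le (h : R.Inv P) (hC : P.IsOptimalCost C)
    (hs : P.Split C d u a b) : (R.secondarySearch d).value d.sec u ≤ b d.sec := by
  obtain ⟨c, -, hc, hle⟩ :=
    (h.secondarySearch d).exists_value_eq (h.mem_closed_secondarySearch hC hs)
  rw [hc]
  exact_mod_cast apply_le_of_lexCost_le (hle b hs.right)

theorem Inv.mem_closed_primarySearch (h : R.Inv P) (hf : R.fwd2.finished)
    (hb : R.back1.finished) (hC : P.IsOptimalCost C) (hs : P.Split C d u a b) :
    u ∈ (R.primarySearch d).closed := by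
  have hr := h.reach_allowed hC hs
  have hle := h.value_secondarySearch_le hC hs.symm
  cases d with
  | fwd =>
    exact h.back1_complete hb u b hr
      ((hs.coe_add_le hle).trans (hC.le_of_isAttained h.attained))
  | bwd =>
    exact h.fwd2_complete hf u b hr
      ((hs.coe_add_le hle).trans (ENNReal.coe_le_coe.2 hC.feasible.2))

theorem Inv.exists_value_primarySearch_eq (h : R.Inv P) (hf : R.fwd2.finished)
    (hb : R.back1.finished) (hC : P.IsOptimalCost C) (hs : P.Split C d u a b) :
    ∃ c : Fin 2 → ℝ≥0, (∀ i, (R.primarySearch d).value i u = c i) ∧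
      lexCost d.pri c ≤ lexCost d.pri b := by
  obtain ⟨c, -, hc, hle⟩ :=
    (h.primarySearch d).exists_value_eq (h.mem_closed_primarySearch hf hb hC hs)
  exact ⟨c, hc, hle b (h.reach_allowed hC hs)⟩

end Round2

end Initialisation

/-! ### The beginning of the constrained search -/

section Beginning

variable {S : Type*} {P : Instance S} {C : Fin 2 → ℝ≥0} {R : Round2 S}

namespace Main

theorem init_primary (R : Round2 S) (d : Dir) (u : S) (i : Fin 2) :
    (Main.init P R).primary d u i = (R.primarySearch d).value i u := by
  cases d <;> fin_cases i <;> rfl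

theorem init_secondary (R : Round2 S) (d : Dir) (u : S) (i : Fin 2) :
    (Main.init P R).secondary d u i = (R.secondarySearch d).value i u := by
  cases d <;> fin_cases i <;> rfl

theorem init_comp (R : Round2 S) (d : Dir) (u : S) :
    (Main.init P R).comp d u = (R.primarySearch d).route u := by
  cases d <;> rfl

theorem init_h_pri (R : Round2 S) (d : Dir) (u : S) :
    (Main.init P R).h d d.pri u = (R.primarySearch d).value d.pri u := by
  rw [← primary_pri, init_primary]

theorem init_ub_sec (R : Round2 S) (d : Dir) (u : S) :
    (Main.init P R).ub d d.sec u = (R.primarySearch d).value d.sec u := by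
  rw [← primary_sec, init_primary]

theorem init_h_sec (R : Round2 S) (d : Dir) (u : S) :
    (Main.init P R).h d d.sec u = (R.secondarySearch d).value d.sec u := by
  rw [← secondary_sec, init_secondary]

theorem not_covered_init (R : Round2 S) (d : Dir) (u : S) (a : Fin 2 → ℝ≥0) :
    ¬ Covered d ((Main.init P R).search d) u a := by
  simp [Covered, Main.init]

theorem progress_init (hC : P.IsOptimalCost C) (d : Dir) (hv : Valid P C (Main.init P R)) :
    Progress P C d ((Main.init P R).search d) where
  root := Or.inl ⟨_, Multiset.mem_singleton_self _, rfl, rfl, hv d _ _ _ (hC.split_initial d)⟩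
  step u _ a _ _ _ _ hc := absurd hc (not_covered_init R d u a)
  target := not_covered_init R d _ C

end Main

namespace Round2

theorem Inv.sound_init (h : R.Inv P) : Main.Sound P (Main.init P R) where
  node d x hx := by
    obtain rfl := Multiset.mem_singleton.1 hx
    exact ⟨.root (Set.mem_univ _), by simp [Main.init]⟩
  primary d u i hi := by
    simp only [Main.init_primary, Main.init_comp] at hi ⊢
    obtain ⟨b, hb, hv, -⟩ :=
      (h.primarySearch d).exists_value_eq (HSearch.mem_closed_of_value_ne_top hi)
    exact ⟨b, hb.mono (Set.subset_univ _), hv⟩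
  secondary d u i hi := by
    simp only [Main.init_secondary] at hi ⊢
    obtain ⟨b, hb, hv, -⟩ :=
      (h.secondarySearch d).exists_value_eq (HSearch.mem_closed_of_value_ne_top hi)
    exact ⟨b, hb.reach, hv⟩
  attained := h.attained
  sol hn := absurd rfl hn
  exists_feasible hn := absurd rfl hn

theorem Inv.exact_init (h : R.Inv P) (hf : R.fwd2.finished) (hb : R.back1.finished)
    (hC : P.IsOptimalCost C) : Main.Exact P C (Main.init P R) where
  le d u a b hs := by
    obtain ⟨c, hc, hle⟩ := h.exists_value_primarySearch_eq hf hb hC hs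
    rw [Main.init_h_pri, hc]
    exact_mod_cast apply_le_of_lexCost_le hle
  ub_le d u a b hs heq := by
    obtain ⟨c, hc, hle⟩ := h.exists_value_primarySearch_eq hf hb hC hs
    rw [Main.init_h_pri, hc] at heq
    rw [Main.init_ub_sec, hc]
    norm_cast at heq ⊢
    rcases lexCost_le_lexCost.1 hle with hlt | ⟨-, hle⟩
    · exact absurd heq hlt.ne
    · rwa [d.other_pri] at hle
  consistent d u v a b a' b' hs hs' ha := by
    rw [Main.init_h_pri, Main.init_h_pri]
    exact (h.primarySearch d).value_le_add (h.mem_closed_primarySearch hf hb hC hs)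
      (h.mem_closed_primarySearch hf hb hC hs') (h.mem_allowed C hC d u a b hs) ha

theorem Inv.valid_init (h : R.Inv P) (hC : P.IsOptimalCost C) :
    Main.Valid P C (Main.init P R) := by
  intro d u a b hs
  rw [Main.init_h_sec]
  exact h.value_secondarySearch_le hC hs

theorem Inv.optimizing_init (h : R.Inv P) (hf : R.fwd2.finished) (hb : R.back1.finished)
    (hC : P.IsOptimalCost C) : Main.Optimizing P C (Main.init P R) where
  exact := h.exact_init hf hb hC
  live := Or.inr ⟨h.valid_init hC, fun d => Main.progress_init hC d (h.valid_init hC)⟩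

end Round2

end Beginning

/-! ### Correctness -/

section Correctness

variable {S : Type*} {P : Instance S} {C : Fin 2 → ℝ≥0} {e₁ e₂ : S → ℝ≥0} {M : Main S} {d : Dir}
  {c c' : Config S}

variable (P) in
/-- The output represents a cost-optimal path, or is empty if there is no feasible path. -/
def Output.IsCorrect (out : Output S) : Prop :=
  ((∃ π, P.IsFeasible π) → ∃ π, out.Represents π ∧ P.IsCostOptimal π) ∧
    ((¬ ∃ π, P.IsFeasible π) → out.sol = (none, none))

variable (P e₁ e₂) in
/-- The invariant of the algorithm. -/
def Config.Inv : Config S → Prop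
  | .round1 r => r.Inv P e₁ e₂
  | .round2 R => R.Inv P
  | .main M => Main.Sound P M ∧ ∀ C, P.IsOptimalCost C → Main.Optimizing P C M
  | .returned out => out.IsCorrect P

theorem Main.Sound.exists_represents_of_solved (h : Main.Sound P M) (hs : Main.Solved C M)
    (hC : P.IsOptimalCost C) : ∃ π, M.toOutput.Represents π ∧ P.IsCostOptimal π := by
  obtain ⟨π, c, hπ, ht, h0, h1⟩ := h.sol (hs.2 ▸ ENNReal.coe_ne_top)
  rw [hs.1, ENNReal.coe_inj] at h0
  rw [hs.2, ENNReal.coe_inj] at h1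
  obtain rfl : C = c := funext (Fin.forall_fin_two.2 ⟨h0, h1⟩)
  exact ⟨π, hπ, hC.isCostOptimal ht⟩

theorem Main.Sound.isCorrect_toOutput [Finite S] (h : Main.Sound P M)
    (ho : ∀ C, P.IsOptimalCost C → Main.Optimizing P C M)
    (hout : ∀ y ∈ (M.search d).opn, M.fbar P d.pri < y.f d.pri) : M.toOutput.IsCorrect P := by
  refine ⟨fun hfeas => ?_, fun hn => ?_⟩
  · obtain ⟨C, hC⟩ := Instance.exists_isOptimalCost (Instance.exists_isFeasible_iff.1 hfeas)
    rcases (ho C hC).live with hs | ⟨-, hp⟩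
    · exact h.exists_represents_of_solved hs hC
    · obtain ⟨y, hy, hf⟩ := (hp d).exists_open h (ho C hC).exact hC
      exact absurd hf (hout y hy).not_ge
  · by_contra hsol
    exact hn (Instance.exists_isFeasible_iff.2 (h.exists_feasible hsol))

variable [Fintype S]

theorem Step.inv (he₁ : P.IsHeuristic .fwd 0 e₁) (he₂ : P.IsHeuristic .bwd 1 e₂)
    (hc : c.Inv P e₁ e₂) (hs : Step P e₁ e₂ c c') : c'.Inv P e₁ e₂ := by
  cases hs with
  | back2_expand r u l hu => exact Round1.Inv.back2_expand hc he₂ hu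
  | back2_finish r hr =>
    have hc : r.Inv P e₁ e₂ := hc
    exact { hc with
      back2 := hc.back2.finish
      back2_complete := hc.back2.complete_finish he₂.consistentOn hr }
  | fwd1_expand r u l hu =>
    have hc : r.Inv P e₁ e₂ := hc
    exact { hc with
      fwd1 := hc.fwd1.expand he₁.consistentOn hu.2.1
      fwd1_complete := HSearch.complete_of_not_finished hu.1 }
  | fwd1_finish r hr =>
    have hc : r.Inv P e₁ e₂ := hc
    exact { hc with
      fwd1 := hc.fwd1.finish
      fwd1_complete := hc.fwd1.complete_finish he₁.consistentOn hr }
  | to_round2 r hb hf => exact Round1.Inv.to_round2 hc he₁ he₂ hb hf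
  | fwd2_expand R u l hu => exact Round2.Inv.fwd2_expand hc hu
  | fwd2_finish R hR =>
    have hc : R.Inv P := hc
    exact { hc with
      fwd2 := hc.fwd2.finish
      fwd2_complete := hc.fwd2.complete_finish hc.consistentOn_back2 hR }
  | back1_expand R u l hu => exact Round2.Inv.back1_expand hc hu
  | back1_finish R hR =>
    have hc : R.Inv P := hc
    exact { hc with
      back1 := hc.back1.finish
      back1_complete := hc.back1.complete_finish hc.consistentOn_fwd1 hR }
  | to_main R hf hb =>
    exact ⟨Round2.Inv.sound_init hc, fun C hC => Round2.Inv.optimizing_init hc hf hb hC⟩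
  | iterate M d x hx hf =>
    exact ⟨hc.1.iterate hx hf, fun C hC => (hc.2 C hC).iterate hC hc.1 hx hf⟩
  | stop_bound M d x hx hf =>
    exact hc.1.isCorrect_toOutput hc.2 fun y hy =>
      hf.trans_le (Prod.Lex.monotone_fst _ _ (hx.2 y hy))
  | stop_empty M d ho => exact hc.1.isCorrect_toOutput hc.2 (d := d) fun y hy => by simp [ho] at hy

theorem Reachable.inv (he₁ : P.IsHeuristic .fwd 0 e₁) (he₂ : P.IsHeuristic .bwd 1 e₂)
    (h : Reachable P e₁ e₂ c) : c.Inv P e₁ e₂ := by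
  induction h with
  | refl => exact Round1.Inv.init
  | tail _ hs ih => exact hs.inv he₁ he₂ ih

end Correctness

/-! ### Termination -/

section PathCosts

variable {S : Type*} {P : Instance S} {M : Main S} {d d' : Dir} {x y : Node S} {c c' : Config S}
  {e₁ e₂ : S → ℝ≥0}

variable (P) in
/-- The possible values of `g_min`: infinity and the sums of costs of edges. -/
def Instance.gminValues : Set ℝ≥0∞ := insert ⊤ ((↑) '' (P.costMonoid : Set ℝ≥0))

theorem Instance.isPWO_gminValues [Finite S] : P.gminValues.IsPWO :=
  (isPWO_costMonoid.image_of_monotone ENNReal.coe_mono).insert ⊤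

variable (P) in
/-- The costs of the open nodes and the values of `g_min` are sums of costs of edges. -/
structure Main.HasPathCosts (M : Main S) : Prop where
  node : ∀ d, ∀ x ∈ (M.search d).opn, ∀ i, x.g i ∈ P.costMonoid
  gmin : ∀ d u, (M.search d).gmin u ∈ P.gminValues

theorem Main.hasPathCosts_init (R : Round2 S) : (Main.init P R).HasPathCosts P where
  node d x hx := by
    obtain rfl := Multiset.mem_singleton.1 hx
    exact fun _ => zero_mem _
  gmin _ _ := Or.inl rfl

theorem Main.HasPathCosts.pop (h : M.HasPathCosts P) : (M.pop d x).HasPathCosts P where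
  node d' y hy := h.node d' y (mem_opn_of_mem_opn_pop hy)
  gmin d' u := by simpa using h.gmin d' u

variable (P) in
/-- `Main.HasPathCosts`, required in the constrained search only. -/
def Config.HasPathCosts (c : Config S) : Prop := ∀ M, c = .main M → M.HasPathCosts P

variable [Fintype S]

theorem Main.mem_opn_explore (hy : y ∈ (((M.pop d x).explore P d x).search d').opn) :
    y ∈ (M.search d').opn ∨ ∃ v, y.g = x.g + P.arcCost d x.state v := by
  have hsettle : y ∈ ((M.settle P d x).search d').opn → y ∈ (M.search d').opn := fun h =>
    mem_opn_of_mem_opn_pop (settle_opn ▸ h)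
  rw [explore_eq] at hy
  split_ifs at hy
  · exact Or.inl (hsettle hy)
  · rcases mem_opn_exp.1 hy with hy | ⟨-, v, -, rfl⟩
    exacts [Or.inl (hsettle hy), Or.inr ⟨v, rfl⟩]

theorem Main.HasPathCosts.explore (h : M.HasPathCosts P) (hx : x ∈ (M.search d).opn) :
    ((M.pop d x).explore P d x).HasPathCosts P where
  node d' y hy i := by
    rcases mem_opn_explore hy with hy | ⟨v, hv⟩
    · exact h.node d' y hy i
    · rw [hv]
      exact add_mem (h.node d x hx i) (Instance.arcCost_mem_costMonoid d _ v i)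
  gmin d' u := by
    rcases d.eq_or_eq_opp d' with rfl | rfl
    · rw [explore_gmin]
      split_ifs
      exacts [Or.inr ⟨_, h.node d' x hx _, rfl⟩, h.gmin d' u]
    · rw [explore_search_opp]
      exact h.gmin _ u

theorem Main.HasPathCosts.iterate (h : M.HasPathCosts P) (hx : x ∈ (M.search d).opn) :
    (M.iterate P d x).HasPathCosts P := by
  simp only [Main.iterate]
  split_ifs
  exacts [h.pop, h.pop, h.explore hx]

theorem Step.hasPathCosts (hc : c.HasPathCosts P) (hs : Step P e₁ e₂ c c') :
    c'.HasPathCosts P := by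
  rintro M rfl
  cases hs with
  | to_main R => exact Main.hasPathCosts_init R
  | iterate M d x hx => exact (hc M rfl).iterate hx.1

end PathCosts

section Rank

variable {S : Type*} {P : Instance S} {e₁ e₂ : S → ℝ≥0} {M : Main S} {d : Dir} {x : Node S}
  {p : Fin 2} {A : Set S} {s : HSearch S} {u : S} {l : Label S} {c c' : Config S}

open scoped Classical in
/-- The number of iterations a bounded A* can still make. -/
def HSearch.remaining (s : HSearch S) : ℕ := s.closedᶜ.ncard + if s.finished then 0 else 1

theorem HSearch.remaining_expand_lt [Finite S] (hu : u ∉ s.closed) :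
    (s.expand P d p A u l).remaining < s.remaining :=
  Nat.add_lt_add_right (Set.ncard_lt_ncard (compl_lt_compl_iff_lt.2 (Set.ssubset_insert hu))) _

theorem HSearch.remaining_finish_lt (hs : ¬ s.finished) : s.finish.remaining < s.remaining := by
  simp [remaining, finish, hs]

/-- A measure that every step decreases: the phases still to come, the values of `g_min` in all
states, and the number of iterations possible before the phase ends or `g_min` decreases. -/
def Config.rank : Config S → ℕ ×ₗ (Dir → S → ℝ≥0∞) ×ₗ ℕ
  | .round1 r => toLex (3, toLex (⊤, r.back2.remaining + r.fwd1.remaining))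
  | .round2 R => toLex (2, toLex (⊤, R.fwd2.remaining + R.back1.remaining))
  | .main M => toLex (1, toLex (fun d => (M.search d).gmin,
      (M.search .fwd).opn.card + (M.search .bwd).opn.card))
  | .returned _ => toLex (0, toLex (⊤, 0))

theorem toLex_toLex_lt {α β γ : Type*} [LT α] [LT β] [LT γ] (a : α) (b : β) {m n : γ}
    (h : m < n) : toLex (a, toLex (b, m)) < toLex (a, toLex (b, n)) :=
  Prod.Lex.right a (Prod.Lex.right b h)

theorem Main.rank_pop_lt (hx : x ∈ (M.search d).opn) :
    (Config.main (M.pop d x)).rank < (Config.main M).rank := by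
  classical
  simp only [Config.rank, pop_gmin]
  refine toLex_toLex_lt _ _ ?_
  have := Multiset.card_erase_lt_of_mem hx
  cases d <;> simpa [pop] using this

instance : Finite Dir :=
  Finite.of_surjective (fun b : Bool => if b then Dir.fwd else Dir.bwd) fun d => by
    cases d
    exacts [⟨true, rfl⟩, ⟨false, rfl⟩]

variable (P) in
theorem Config.isPWO_rank_image [Finite S] :
    (rank '' {c : Config S | c.HasPathCosts P}).IsPWO := by
  have hgmin : (Set.univ.pi fun _ : Dir => Set.univ.pi fun _ : S => P.gminValues).IsPWO :=
    Set.IsPWO.pi fun _ => Set.IsPWO.pi fun _ => Instance.isPWO_gminValues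
  have hprod := (Set.isPWO_of_wellQuasiOrderedLE (Set.univ : Set ℕ)).prod
    ((hgmin.prod (Set.isPWO_of_wellQuasiOrderedLE (Set.univ : Set ℕ))).image_of_monotone
      Prod.Lex.toLex_mono)
  refine (hprod.image_of_monotone Prod.Lex.toLex_mono).mono ?_
  have hmem : ∀ n g k, (∀ d u, g d u ∈ P.gminValues) →
      (toLex (n, toLex (g, k)) : ℕ ×ₗ (Dir → S → ℝ≥0∞) ×ₗ ℕ) ∈
        toLex '' Set.univ ×ˢ (toLex '' (Set.univ.pi fun _ => Set.univ.pi fun _ => P.gminValues)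
          ×ˢ Set.univ) := fun n g k hg =>
    ⟨_, ⟨trivial, (g, k), ⟨fun d _ u _ => hg d u, trivial⟩, rfl⟩, rfl⟩
  rintro _ ⟨c, hc, rfl⟩
  cases c with
  | main M => exact hmem _ _ _ (hc M rfl).gmin
  | round1 | round2 | returned => exact hmem _ _ _ fun _ _ => Or.inl rfl

variable [Fintype S]

theorem Main.gmin_explore_lt (h : (x.g d.sec : ℝ≥0∞) < (M.search d).gmin x.state) :
    (fun d' => (((M.pop d x).explore P d x).search d').gmin) <
      fun d' => (M.search d').gmin := by
  classical
  have hgmin : (((M.pop d x).explore P d x).search d).gmin =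
      Function.update (M.search d).gmin x.state (x.g d.sec) :=
    funext fun v => by rw [explore_gmin, Function.update_apply]
  have hlt : (((M.pop d x).explore P d x).search d).gmin < (M.search d).gmin := by
    rw [hgmin]
    exact update_lt_self_iff.2 h
  refine Pi.lt_def.2 ⟨fun d' => ?_, d, hlt⟩
  rcases d.eq_or_eq_opp d' with rfl | rfl
  exacts [hlt.le, (congrArg Search.gmin explore_search_opp).le]

theorem Main.rank_iterate_lt (hx : x ∈ (M.search d).opn) :
    (Config.main (M.iterate P d x)).rank < (Config.main M).rank := by
  simp only [Main.iterate, pop_gmin]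
  split_ifs with hbound hdom
  · exact rank_pop_lt hx
  · exact rank_pop_lt hx
  · exact Prod.Lex.right _ (Prod.Lex.left _ _ (gmin_explore_lt (not_le.1 hdom)))

theorem Step.rank_lt (hs : Step P e₁ e₂ c c') : c'.rank < c.rank := by
  cases hs with
  | back2_expand r u l hu =>
    exact toLex_toLex_lt _ _ (add_lt_add_left (HSearch.remaining_expand_lt hu.2.1.1.2) _)
  | back2_finish r hr =>
    exact toLex_toLex_lt _ _ (add_lt_add_left (HSearch.remaining_finish_lt hr.1) _)
  | fwd1_expand r u l hu =>
    exact toLex_toLex_lt _ _ (add_lt_add_right (HSearch.remaining_expand_lt hu.2.1.1.2) _)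
  | fwd1_finish r hr =>
    exact toLex_toLex_lt _ _ (add_lt_add_right (HSearch.remaining_finish_lt hr.1) _)
  | fwd2_expand R u l hu =>
    exact toLex_toLex_lt _ _ (add_lt_add_left (HSearch.remaining_expand_lt hu.2.1.1.2) _)
  | fwd2_finish R hR =>
    exact toLex_toLex_lt _ _ (add_lt_add_left (HSearch.remaining_finish_lt hR.1) _)
  | back1_expand R u l hu =>
    exact toLex_toLex_lt _ _ (add_lt_add_right (HSearch.remaining_expand_lt hu.2.1.1.2) _)
  | back1_finish R hR =>
    exact toLex_toLex_lt _ _ (add_lt_add_right (HSearch.remaining_finish_lt hR.1) _)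
  | iterate M d x hx hf => exact Main.rank_iterate_lt hx.1
  | to_round2 | to_main | stop_bound | stop_empty => exact Prod.Lex.left _ _ (by norm_num)

theorem not_exists_infinite_run :
    ¬ ∃ run : ℕ → Config S, run 0 = initConfig P ∧ ∀ n, Step P e₁ e₂ (run n) (run (n + 1)) := by
  rintro ⟨run, h0, hstep⟩
  have hpath : ∀ n, (run n).HasPathCosts P := by
    intro n
    induction n with
    | zero => exact fun M hM => by cases h0.symm.trans hM
    | succ n ih => exact (hstep n).hasPathCosts ih
  have hanti : StrictAnti fun n => (run n).rank :=
    strictAnti_nat_of_succ_lt fun n => (hstep n).rank_lt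
  exact Set.isWF_iff_no_descending_seq.1 (Config.isPWO_rank_image P).isWF _ hanti
    fun n => Set.mem_image_of_mem _ (hpath n)

end Rank

/-! ### Progress -/

section Liveness

variable {S : Type*}

theorem HSearch.canExpand_or_canFinish [Finite S] {s : HSearch S} (hs : ¬ s.finished)
    (p : Fin 2) (e : S → ℝ≥0∞) (bound : ℝ≥0∞) :
    (∃ u l, s.CanExpand p e bound u l) ∨ s.CanFinish p e bound := by
  by_cases ho : ∃ u l, s.IsOpen u l
  · obtain ⟨u, ⟨l, hl⟩, hmin⟩ := Set.exists_min_image {u | ∃ l, s.IsOpen u l}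
      (fun u => (s.label u).elim (toLex (0, 0)) (key p e u)) (Set.toFinite _) ho
    have hleast : s.IsLeast p e u l := by
      refine ⟨hl, fun u' l' hl' => ?_⟩
      simpa [hl.1, hl'.1] using hmin u' ⟨l', hl'⟩
    by_cases hb : (l.cost p : ℝ≥0∞) + e u ≤ bound
    · exact Or.inl ⟨u, l, hs, hleast, hb⟩
    · exact Or.inr ⟨hs, Or.inr ⟨u, l, hleast, not_le.1 hb⟩⟩
  · push Not at ho
    exact Or.inr ⟨hs, Or.inl ho⟩

theorem Main.exists_isLeast {M : Main S} {d : Dir} (h : (M.search d).opn ≠ 0) :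
    ∃ x, M.IsLeast d x := by
  classical
  obtain ⟨x, hx⟩ := Multiset.exists_mem_of_ne_zero h
  obtain ⟨y, hy, hmin⟩ := (M.search d).opn.toFinset.exists_min_image
    (fun y => toLex (y.f d.pri, y.f d.sec)) ⟨x, Multiset.mem_toFinset.2 hx⟩
  exact ⟨y, Multiset.mem_toFinset.1 hy, fun z hz => hmin z (Multiset.mem_toFinset.2 hz)⟩

theorem exists_step [Fintype S] (P : Instance S) (e₁ e₂ : S → ℝ≥0) (c : Config S) :
    (∃ out, c = .returned out) ∨ ∃ c', Step P e₁ e₂ c c' := by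
  cases c with
  | round1 r =>
    right
    by_cases hb : r.back2.finished
    · by_cases hf : r.fwd1.finished
      · exact ⟨_, .to_round2 r hb hf⟩
      · rcases HSearch.canExpand_or_canFinish hf _ _ _ with ⟨u, l, h⟩ | h
        exacts [⟨_, .fwd1_expand r u l h⟩, ⟨_, .fwd1_finish r h⟩]
    · rcases HSearch.canExpand_or_canFinish hb _ _ _ with ⟨u, l, h⟩ | h
      exacts [⟨_, .back2_expand r u l h⟩, ⟨_, .back2_finish r h⟩]
  | round2 R =>
    right
    by_cases hf : R.fwd2.finished
    · by_cases hb : R.back1.finished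
      · exact ⟨_, .to_main R hf hb⟩
      · rcases HSearch.canExpand_or_canFinish hb _ _ _ with ⟨u, l, h⟩ | h
        exacts [⟨_, .back1_expand R u l h⟩, ⟨_, .back1_finish R h⟩]
    · rcases HSearch.canExpand_or_canFinish hf _ _ _ with ⟨u, l, h⟩ | h
      exacts [⟨_, .fwd2_expand R u l h⟩, ⟨_, .fwd2_finish R h⟩]
  | main M =>
    right
    by_cases ho : (M.search .fwd).opn = 0
    · exact ⟨_, .stop_empty M .fwd ho⟩
    · obtain ⟨x, hx⟩ := Main.exists_isLeast ho
      by_cases hf : x.f Dir.fwd.pri ≤ M.fbar P Dir.fwd.pri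
      · exact ⟨_, .iterate M .fwd x hx hf⟩
      · exact ⟨_, .stop_bound M .fwd x hx (not_le.1 hf)⟩
  | returned out => exact Or.inl ⟨out, rfl⟩

end Liveness

end WCSPP

end

theorem mainTheorem4 {S : Type*} [Fintype S] (P : WCSPP.Instance S) (e₁ e₂ : S → ℝ≥0)
    (he₁ : P.IsHeuristic .fwd 0 e₁) (he₂ : P.IsHeuristic .bwd 1 e₂) :
    (¬ ∃ run : ℕ → WCSPP.Config S, run 0 = WCSPP.initConfig P ∧
      ∀ n, WCSPP.Step P e₁ e₂ (run n) (run (n + 1))) ∧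
    (∀ c, WCSPP.Reachable P e₁ e₂ c →
      (∃ out, c = .returned out) ∨ ∃ c', WCSPP.Step P e₁ e₂ c c') ∧
    (∀ out, WCSPP.Reachable P e₁ e₂ (.returned out) →
      ((∃ π, P.IsFeasible π) → ∃ π, out.Represents π ∧ P.IsCostOptimal π) ∧
      ((¬ ∃ π, P.IsFeasible π) → out.sol = (none, none))) :=
  ⟨WCSPP.not_exists_infinite_run, fun c _ => WCSPP.exists_step P e₁ e₂ c,
    fun _ h => h.inv he₁ he₂⟩
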